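/- Let $(\mathcal A,\mathcal H,D)_\sigma$ be a twisted spectral triple: $\mathcal H=\mathcal H^+\oplus\mathcal H^-$ is a $\mathbb Z_2$-graded complex Hilbert space, $\mathcal A$ is a unital involutive complex algebra represented (unitally, by a $*$-representation) by even bounded operators on $\mathcal H$, $\sigma$ is an algebra automorphism of $\mathcal A$ with $\sigma(a)^*=\sigma^{-1}(a^*)$, and $D$ is an odd selfadjoint unbounded operator on $\mathcal H$ with compact resolvent such that $a(\operatorname{dom}D)\subset\operatorname{dom}D$ and $Da-\sigma(a)D$ is bounded for all $a\in\mathcal A$. Let $\mathcal E$ be a finitely generated projective right $\mathcal A$-module with a $\sigma$-translation $(\mathcal E^\sigma,\sigma^{\mathcal E})$, i.e. $\mathcal E^\sigma$ is a finitely generated projective right $\mathcal A$-module and $\sigma^{\mathcal E}:\mathcal E\to\mathcal E^\sigma$ is a $\mathbb C$-linear isomorphism with $\sigma^{\mathcal E}(\xi a)=\sigma^{\mathcal E}(\xi)\sigma(a)$. Let $\{(\cdot,\cdot),\mathfrak s\}$ be a $\sigma$-Hermitian structure on $\mathcal E$: a Hermitian metric $(\cdot,\cdot):\mathcal E\times\mathcal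 E\to\mathcal A$ ($\mathcal A$-antilinear in the first and $\mathcal A$-linear in the second variable, with $(\xi,\xi)\ge 0$ as an operator on $\mathcal H$, and with $\xi\mapsto(\xi,\cdot)$ a bijection of $\mathcal E$ onto $\operatorname{Hom}_{\mathcal A}(\mathcal E,\mathcal A)$) and a right-module isomorphism $\mathfrak s:\mathcal E^\sigma\to\mathcal E$ such that $(\xi_1,\mathfrak s\sigma^{\mathcal E}\xi_2)=\sigma[(\mathfrak s\sigma^{\mathcal E}\xi_1,\xi_2)]$. Let $\mathcal H(\mathcal E)=\mathcal E\otimes_{\mathcal A}\mathcal H$ be the Hilbert space with inner product $\langle\xi_1\otimes\zeta_1,\xi_2\otimes\zeta_2\rangle=\langle\zeta_1,(\xi_1,\xi_2)\zeta_2\rangle$, and let $\mathcal H(\mathcal E^\sigma)$ be defined in the same way from the metric $(\eta_1,\eta_2)\mapsto(\mathfrak s\eta_1,\mathfrak s\eta_2)$ of $\mathcal E^\sigma$; then $S=\mathfrak s\otimes1$ is a unitary operator from $\mathcal H(\mathcal E^\sigma)$ onto $\mathcal H(\mathcal E)$. Let $T$ be a densely defined operator from $\mathcal H(\mathcal E)$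 to $\mathcal H(\mathcal E^\sigma)$ which is Fredholm (closed, with finite-dimensional kernel and closed range of finite codimension) and $\mathfrak s$-selfadjoint, i.e. $T=T^\dagger$, where the $\mathfrak s$-adjoint $T^\dagger$ has the graph $\{(\xi,\eta):\langle\xi,ST\zeta\rangle=\langle S\eta,\zeta\rangle\ \forall\zeta\in\operatorname{dom}T\}$. Assume moreover that the resolvent $(ST+i)^{-1}$ is compact. Throughout, $j$ runs over the integers $j\ge1$ with $j\le\dim\mathcal H(\mathcal E)$ (that is, over all $j\ge1$ if $\mathcal H(\mathcal E)$ is infinite-dimensional). Then: 1. The $\mathfrak s$-eigenvalues of $T$, i.e. the eigenvalues of $ST$, are real with finite multiplicity and can be arranged in a sequence $(\lambda_j(T))$ in which each is repeated according to multiplicity and $|\lambda_1(T)|\le|\lambda_2(T)|\le\cdots$. The absolute value $|T|=\sqrt{T^*T}$ (a nonnegative selfadjoint operator with $|T|^2=T^*T$) exists, and its eigenvalues have finite multiplicity and can be arranged in a nondecreasing sequence $(\mu_j(T))$, each repeated according to multiplicity; $\mu_j(T)$ is the $j$-th characteristic value of $T$. 2. For every such arrangement and every $j$ as above, $$|\lambda_j(T)|=\mu_j(T)=\sup_{\substack{F\subset\mathcal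 H(\mathcal E)\\ \dim F=j-1}}\ \inf\left\{\|T\zeta\|:\ \zeta\in F^\perp\cap\operatorname{dom}T,\ \|\zeta\|=1\right\}.$$ -/

import Mathlib

open scoped TensorProduct InnerProductSpace

namespace TwistedGeometry

section Positivity

theorem apply_negPart_eq_zero {K : Type*} [NormedAddCommGroup K] [InnerProductSpace ℂ K]
    [CompleteSpace K] (M : K →L[ℂ] K) (hM : IsSelfAdjoint M) (v : K)
    (h : 0 ≤ RCLike.re ⟪M⁻ v, M (M⁻ v)⟫_ℂ) : M⁻ v = 0 := by
  have hdec : M * M⁻ = - (M⁻ * M⁻) := by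
    have h1 : (M⁺ - M⁻) * M⁻ = - (M⁻ * M⁻) := by
      rw [sub_mul, CFC.posPart_mul_negPart, zero_sub]
    rwa [CFC.posPart_sub_negPart M hM] at h1
  have hnn : (M⁻).IsPositive :=
    (ContinuousLinearMap.nonneg_iff_isPositive _).1 (CFC.negPart_nonneg M)
  have hM2 : M (M⁻ v) = - M⁻ (M⁻ v) := by
    have := congrArg (fun N : K →L[ℂ] K => N v) hdec
    simpa using this
  rw [hM2, inner_neg_right, map_neg] at h
  have h2 := hnn.re_inner_nonneg_right (M⁻ v)
  have h3 : RCLike.re ⟪M⁻ v, M⁻ (M⁻ v)⟫_ℂ = 0 := by linarith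
  have h4 : M⁻ (M⁻ v) = 0 := by
    obtain ⟨B, hB⟩ := (CStarAlgebra.nonneg_iff_eq_star_mul_self (a := M⁻)).1 (CFC.negPart_nonneg M)
    have hB' : ∀ w, M⁻ w = B.adjoint (B w) := fun w => by
      conv_lhs => rw [hB]
      rfl
    rw [hB' (M⁻ v), ContinuousLinearMap.adjoint_inner_right, inner_self_eq_norm_sq] at h3
    have : B (M⁻ v) = 0 := by simpa using h3
    rw [hB', this, map_zero]
  have h5 : ⟪M⁻ v, M⁻ v⟫_ℂ = 0 := by
    rw [hnn.inner_left_eq_inner_right, h4, inner_zero_right]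
  exact inner_self_eq_zero.1 h5

theorem positive_aux' {A H K : Type*} [Ring A] [StarRing A] [Algebra ℂ A]
    [NormedAddCommGroup H] [InnerProductSpace ℂ H] [CompleteSpace H]
    [NormedAddCommGroup K] [InnerProductSpace ℂ K] [CompleteSpace K]
    (π : A →⋆ₐ[ℂ] (H →L[ℂ] H)) {ι : Type*} [Fintype ι] [DecidableEq ι]
    (e : ι → H →L[ℂ] K) (p : ι → K →L[ℂ] H)
    (hpe : ∀ i j z, p i (e j z) = if i = j then z else 0)
    (hadj : ∀ i x z, ⟪x, e i z⟫_ℂ = ⟪p i x, z⟫_ℂ)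
    (hsum : ∀ x, x = ∑ k, e k (p k x))
    (m : ι → ι → A) (hsa : ∀ i j, π (m j i) = star (π (m i j)))
    (hpos : ∀ a : ι → A, (π (∑ i, ∑ j, star (a i) * m i j * a j)).IsPositive) (ζ : ι → H) :
    0 ≤ RCLike.re (∑ i, ∑ j, ⟪ζ i, π (m i j) (ζ j)⟫_ℂ) := by
  obtain ⟨M, hM⟩ : ∃ M : K →L[ℂ] K, ∀ x, M x = ∑ i, ∑ j, e i (π (m i j) (p j x)) :=
    ⟨∑ i, ∑ j, e i ∘L π (m i j) ∘L p j, fun x => by simp⟩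
  have hMp : ∀ x i, p i (M x) = ∑ j, π (m i j) (p j x) := by
    intro x i
    simp only [hM, map_sum, hpe]
    rw [Finset.sum_eq_single i]
    · simp
    · intro b _ hb
      simp [hb.symm]
    · simp
  have hMi : ∀ x y : K, ⟪x, M y⟫_ℂ = ∑ i, ∑ j, ⟪p i x, π (m i j) (p j y)⟫_ℂ := by
    intro x y
    simp only [hM, inner_sum, hadj]
  have hMsa : IsSelfAdjoint M := by
    rw [ContinuousLinearMap.isSelfAdjoint_iff_isSymmetric]
    intro x y
    change ⟪M x, y⟫_ℂ = ⟪x, M y⟫_ℂ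
    rw [← inner_conj_symm, hMi, hMi, map_sum]
    simp only [map_sum]
    rw [Finset.sum_comm]
    refine Finset.sum_congr rfl fun i _ => Finset.sum_congr rfl fun j _ => ?_
    rw [inner_conj_symm, hsa i j, ContinuousLinearMap.star_eq_adjoint,
      ContinuousLinearMap.adjoint_inner_left]
  have hP : ∀ N ∈ NonUnitalStarAlgebra.adjoin ℝ {M},
      ∀ k, ∃ a : ι → A, ∀ z i, p i (N (e k z)) = π (a i) z := by
    intro N hN
    induction hN using NonUnitalStarAlgebra.adjoin_induction with
    | mem x hx =>
      rw [Set.mem_singleton_iff] at hx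
      subst hx
      intro k
      refine ⟨fun i => m i k, fun z i => ?_⟩
      rw [hMp, Finset.sum_eq_single k]
      · simp [hpe]
      · intro b _ hb
        simp [hpe, hb]
      · simp
    | add x y _ _ hx hy =>
      intro k
      obtain ⟨a, ha⟩ := hx k
      obtain ⟨b, hb⟩ := hy k
      exact ⟨a + b, fun z i => by simp [ha, hb]⟩
    | zero => exact fun k => ⟨0, fun z i => by simp⟩
    | mul x y _ _ hx hy =>
      intro k
      choose a ha using hx
      obtain ⟨b, hb⟩ := hy k
      refine ⟨fun i => ∑ l, a l i * b l, fun z i => ?_⟩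
      change p i (x (y (e k z))) = _
      rw [hsum (y (e k z))]
      simp [ha, hb, map_sum]
    | smul r x _ hx =>
      intro k
      obtain ⟨a, ha⟩ := hx k
      refine ⟨fun i => (r : ℂ) • a i, fun z i => ?_⟩
      have : r • x = (r : ℂ) • x := (Complex.coe_smul r x).symm
      rw [this, map_smul]
      simp [ha]
    | star x _ hx =>
      intro k
      choose a ha using hx
      refine ⟨fun i => star (a i k), fun z i => ?_⟩
      refine ext_inner_right ℂ fun w => ?_
      rw [← hadj, ContinuousLinearMap.star_eq_adjoint, ContinuousLinearMap.adjoint_inner_left,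
        map_star, ContinuousLinearMap.star_eq_adjoint, ContinuousLinearMap.adjoint_inner_left,
        ← ha, ← inner_conj_symm, hadj, inner_conj_symm]
  have hquad : ∀ N ∈ NonUnitalStarAlgebra.adjoin ℝ {M},
      ∀ k z, 0 ≤ RCLike.re ⟪N (e k z), M (N (e k z))⟫_ℂ := by
    intro N hN k z
    obtain ⟨a, ha⟩ := hP N hN k
    have h1 := (hpos a).re_inner_nonneg_right z
    rw [hMi]
    convert h1 using 2
    simp only [ha, map_sum, inner_sum, sum_apply, map_mul]
    refine Finset.sum_congr rfl fun i _ => Finset.sum_congr rfl fun j _ => ?_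
    rw [map_star, ContinuousLinearMap.star_eq_adjoint]
    exact (ContinuousLinearMap.adjoint_inner_right _ _ _).symm
  have hneg : M⁻ ∈ closure {N : K →L[ℂ] K | N ∈ NonUnitalStarAlgebra.adjoin ℝ {M}} :=
    cfcₙ_mem_elemental (fun x : ℝ => x⁻) M
  have hquad' : ∀ k z, 0 ≤ RCLike.re ⟪M⁻ (e k z), M (M⁻ (e k z))⟫_ℂ := by
    intro k z
    have hcl : IsClosed {N : K →L[ℂ] K | 0 ≤ RCLike.re ⟪N (e k z), M (N (e k z))⟫_ℂ} := by
      refine isClosed_le continuous_const ?_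
      fun_prop
    exact closure_minimal (fun N hN => hquad N hN k z) hcl hneg
  have hneg0 : M⁻ = 0 := by
    ext1 x
    rw [hsum x, map_sum]
    simp [apply_negPart_eq_zero M hMsa _ (hquad' _ _)]
  have hM0 : 0 ≤ M := (CFC.negPart_eq_zero_iff M hMsa).1 hneg0
  have h1 := ((ContinuousLinearMap.nonneg_iff_isPositive M).1 hM0).re_inner_nonneg_right
    (∑ k, e k (ζ k))
  rw [hMi] at h1
  simpa [map_sum, hpe] using h1

theorem positive_aux {A H : Type*} [Ring A] [StarRing A] [Algebra ℂ A]
    [NormedAddCommGroup H] [InnerProductSpace ℂ H] [CompleteSpace H]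
    (π : A →⋆ₐ[ℂ] (H →L[ℂ] H)) {ι : Type*} [Fintype ι]
    (m : ι → ι → A) (hsa : ∀ i j, π (m j i) = star (π (m i j)))
    (hpos : ∀ a : ι → A, (π (∑ i, ∑ j, star (a i) * m i j * a j)).IsPositive) (ζ : ι → H) :
    0 ≤ RCLike.re (∑ i, ∑ j, ⟪ζ i, π (m i j) (ζ j)⟫_ℂ) := by
  classical
  refine positive_aux' (K := PiLp 2 (fun _ : ι => H)) π
    (fun i => (PiLp.continuousLinearEquiv 2 ℂ (fun _ : ι => H)).symm.toContinuousLinearMap ∘L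
      ContinuousLinearMap.single ℂ (fun _ : ι => H) i)
    (fun i => PiLp.proj 2 (fun _ : ι => H) i) ?_ ?_ ?_ m hsa hpos ζ
  · intro i j z
    simp
  · intro i x z
    simp [PiLp.inner_apply, apply_ite]
  · intro x
    ext i
    simp [Pi.single_apply]

end Positivity

section HilbertTensor

set_option linter.unusedSectionVars false

variable {A H : Type*} [Ring A] [StarRing A] [Algebra ℂ A] [StarModule ℂ A]
  [NormedAddCommGroup H] [InnerProductSpace ℂ H] [CompleteSpace H]

/-- A Hermitian metric `(·, ·)` on the right `A`-module `E`, where the involutive algebra `A` is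
represented on `H` by `π`.  It is `A`-antilinear in the first and `A`-linear in the second
variable (right `A`-modules are modules over `Aᵐᵒᵖ`), positive, and `ξ ↦ (ξ, ·)` is a bijection
from `E` onto the dual module `Hom_A(E, A)`. -/
structure HermitianMetric (π : A →⋆ₐ[ℂ] (H →L[ℂ] H)) (E : Type*) [AddCommGroup E]
    [Module Aᵐᵒᵖ E] where
  pair : E → E →ₗ[Aᵐᵒᵖ] A
  add_left : ∀ ξ₁ ξ₂ η : E, pair (ξ₁ + ξ₂) η = pair ξ₁ η + pair ξ₂ η
  smul_left : ∀ (ξ : E) (a : A) (η : E), pair (MulOpposite.op a • ξ) η = star a * pair ξ η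
  nonneg : ∀ ξ : E, (π (pair ξ ξ)).IsPositive
  bijective : Function.Bijective pair

variable {π : A →⋆ₐ[ℂ] (H →L[ℂ] H)} {E : Type*} [AddCommGroup E] [Module ℂ E] [Module Aᵐᵒᵖ E]
  [IsScalarTower ℂ Aᵐᵒᵖ E]

/-- The relations `ξ a ⊗ ζ = ξ ⊗ a ζ` defining `E ⊗_A H` as a quotient of `E ⊗_ℂ H`. -/
def balanced (π : A →⋆ₐ[ℂ] (H →L[ℂ] H)) (E : Type*) [AddCommGroup E] [Module ℂ E]
    [Module Aᵐᵒᵖ E] : Submodule ℂ (E ⊗[ℂ] H) :=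
  Submodule.span ℂ {t | ∃ (ξ : E) (a : A) (ζ : H),
    t = (MulOpposite.op a • ξ) ⊗ₜ[ℂ] ζ - ξ ⊗ₜ[ℂ] (π a ζ)}

/-- The space `H(E) = E ⊗_A H`.  The metric is recorded in the type, because the inner product
below depends on it. -/
def HilbertTensor (_h : HermitianMetric π E) : Type _ := (E ⊗[ℂ] H) ⧸ balanced π E

instance (h : HermitianMetric π E) : AddCommGroup (HilbertTensor h) :=
  inferInstanceAs (AddCommGroup ((E ⊗[ℂ] H) ⧸ balanced π E))

instance (h : HermitianMetric π E) : Module ℂ (HilbertTensor h) :=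
  inferInstanceAs (Module ℂ ((E ⊗[ℂ] H) ⧸ balanced π E))

namespace HilbertTensor

/-- The quotient map `E ⊗_ℂ H → E ⊗_A H`. -/
noncomputable def mk (h : HermitianMetric π E) : E ⊗[ℂ] H →ₗ[ℂ] HilbertTensor h := (balanced π E).mkQ

/-- The elementary tensor `ξ ⊗ ζ`. -/
noncomputable def tmul (h : HermitianMetric π E) (ξ : E) (ζ : H) : HilbertTensor h := mk h (ξ ⊗ₜ[ℂ] ζ)

theorem tmul_smul (h : HermitianMetric π E) (ξ : E) (a : A) (ζ : H) :
    tmul h (MulOpposite.op a • ξ) ζ = tmul h ξ (π a ζ) :=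
  (Submodule.Quotient.eq _).2 (Submodule.subset_span ⟨ξ, a, ζ, rfl⟩)

theorem induction {h : HermitianMetric π E} {P : HilbertTensor h → Prop} (x : HilbertTensor h)
    (zero : P 0) (tm : ∀ ξ ζ, P (tmul h ξ ζ)) (add : ∀ x y, P x → P y → P (x + y)) : P x := by
  obtain ⟨t, rfl⟩ := Submodule.mkQ_surjective (balanced π E) x
  induction t using TensorProduct.induction_on with
  | zero =>
    rw [map_zero]
    exact zero
  | tmul ξ ζ => exact tm ξ ζ
  | add s t hs ht =>
    rw [map_add]
    exact add _ _ hs ht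

/-- The linear map out of `E ⊗_A H` induced by a balanced bilinear map. -/
noncomputable def lift (h : HermitianMetric π E) {V : Type*} [AddCommGroup V] [Module ℂ V]
    (f : E →ₗ[ℂ] H →ₗ[ℂ] V)
    (hf : ∀ ξ a ζ, f (MulOpposite.op a • ξ) ζ = f ξ (π a ζ)) : HilbertTensor h →ₗ[ℂ] V :=
  (balanced π E).liftQ (TensorProduct.lift f) (by
    refine Submodule.span_le.2 ?_
    rintro _ ⟨ξ, a, ζ, rfl⟩
    simp [hf])

@[simp] theorem lift_tmul (h : HermitianMetric π E) {V : Type*} [AddCommGroup V] [Module ℂ V]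
    (f : E →ₗ[ℂ] H →ₗ[ℂ] V)
    (hf : ∀ ξ a ζ, f (MulOpposite.op a • ξ) ζ = f ξ (π a ζ)) (ξ : E) (ζ : H) :
    lift h f hf (tmul h ξ ζ) = f ξ ζ := by
  exact ((balanced π E).liftQ_apply (TensorProduct.lift f) _).trans (TensorProduct.lift.tmul _ _)

theorem tmul_add (h : HermitianMetric π E) (ξ : E) (ζ ζ' : H) :
    tmul h ξ (ζ + ζ') = tmul h ξ ζ + tmul h ξ ζ' := by
  simp [tmul, TensorProduct.tmul_add]

theorem tmul_smul' (h : HermitianMetric π E) (c : ℂ) (ξ : E) (ζ : H) :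
    tmul h ξ (c • ζ) = c • tmul h ξ ζ := by
  simp [tmul]

theorem add_tmul (h : HermitianMetric π E) (ξ ξ' : E) (ζ : H) :
    tmul h (ξ + ξ') ζ = tmul h ξ ζ + tmul h ξ' ζ := by
  simp [tmul, TensorProduct.add_tmul]

theorem smul_tmul (h : HermitianMetric π E) (c : ℂ) (ξ : E) (ζ : H) :
    tmul h (c • ξ) ζ = c • tmul h ξ ζ := by
  rw [tmul, ← TensorProduct.smul_tmul', map_smul, tmul]

theorem sum_tmul (h : HermitianMetric π E) {ι : Type*} (s : Finset ι) (f : ι → E) (ζ : H) :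
    tmul h (∑ i ∈ s, f i) ζ = ∑ i ∈ s, tmul h (f i) ζ := by
  simp [tmul, TensorProduct.sum_tmul]

/-- The map `φ ⊗ 1 : E ⊗_A H → A ⊗_A H = H` for `φ` in the dual module. -/
noncomputable def contract (h : HermitianMetric π E) (φ : E →ₗ[Aᵐᵒᵖ] A) : HilbertTensor h →ₗ[ℂ] H :=
  lift h (LinearMap.mk₂ ℂ (fun ξ ζ => π (φ ξ) ζ) (by simp)
    (by
      intro c ξ ζ
      have : φ (c • ξ) = c • φ ξ := (φ.restrictScalars ℂ).map_smul c ξ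
      simp [this])
    (by simp) (by simp))
    (by intro ξ a ζ; simp)

@[simp] theorem contract_tmul (h : HermitianMetric π E) (φ : E →ₗ[Aᵐᵒᵖ] A) (ξ : E) (ζ : H) :
    contract h φ (tmul h ξ ζ) = π (φ ξ) ζ := by
  exact (lift_tmul _ _ _ _ _).trans rfl

theorem contract_pair_add (h : HermitianMetric π E) (ξ η : E) (x : HilbertTensor h) :
    contract h (h.pair (ξ + η)) x = contract h (h.pair ξ) x + contract h (h.pair η) x := by
  induction x using induction with
  | zero => simp
  | tm ξ' ζ => simp [h.add_left]
  | add x y hx hy => simp only [map_add, hx, hy]; abel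

theorem contract_pair_op_smul (h : HermitianMetric π E) (a : A) (ξ : E) (x : HilbertTensor h) :
    contract h (h.pair (MulOpposite.op a • ξ)) x = π (star a) (contract h (h.pair ξ) x) := by
  induction x using induction with
  | zero => simp
  | tm ξ' ζ => simp [h.smul_left]
  | add x y hx hy => simp only [map_add, hx, hy]

theorem smul_eq_op_smul (c : ℂ) (ξ : E) :
    c • ξ = MulOpposite.op (algebraMap ℂ A c) • ξ := by
  rw [← MulOpposite.algebraMap_apply, algebraMap_smul]

theorem contract_pair_smul (h : HermitianMetric π E) (c : ℂ) (ξ : E) (x : HilbertTensor h) :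
    contract h (h.pair (c • ξ)) x = (starRingEnd ℂ) c • contract h (h.pair ξ) x := by
  rw [smul_eq_op_smul (A := A), contract_pair_op_smul, ← algebraMap_star_comm, AlgHomClass.commutes]
  simp [Algebra.algebraMap_eq_smul_one]

/-- The form on `E ⊗_A H`, linear in the second variable:
`⟨ξ₁ ⊗ ζ₁, ξ₂ ⊗ ζ₂⟩ = ⟨ζ₁, (ξ₁, ξ₂) ζ₂⟩`; see `form_tmul_tmul`. -/
noncomputable def form (h : HermitianMetric π E) (x : HilbertTensor h) : HilbertTensor h →ₗ[ℂ] ℂ :=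
  lift h (LinearMap.mk₂ ℂ (fun η ζ => ⟪contract h (h.pair η) x, ζ⟫_ℂ)
    (by simp [contract_pair_add])
    (by intro c m n; simp [contract_pair_smul, mul_comm])
    (by simp) (by simp))
    (by
      intro η a ζ
      simp only [LinearMap.mk₂_apply, contract_pair_op_smul, map_star,
        ContinuousLinearMap.star_eq_adjoint]
      exact ContinuousLinearMap.adjoint_inner_left _ _ _)

theorem form_tmul (h : HermitianMetric π E) (x : HilbertTensor h) (η : E) (ζ : H) :
    form h x (tmul h η ζ) = ⟪contract h (h.pair η) x, ζ⟫_ℂ := by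
  exact (lift_tmul _ _ _ _ _).trans rfl

theorem pair_conj (h : HermitianMetric π E) (ξ η : E) :
    π (h.pair η ξ) = star (π (h.pair ξ η)) := by
  have hsa : ∀ ξ, star (π (h.pair ξ ξ)) = π (h.pair ξ ξ) := fun ξ => (h.nonneg ξ).isSelfAdjoint
  have hs : ∀ (c : ℂ) (ξ η : E), h.pair ξ (c • η) = c • h.pair ξ η := fun c ξ η =>
    ((h.pair ξ).restrictScalars ℂ).map_smul c η
  have hs' : ∀ (c : ℂ) (ξ η : E), h.pair (c • ξ) η = star c • h.pair ξ η := fun c ξ η => by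
    rw [smul_eq_op_smul (A := A), h.smul_left, ← algebraMap_star_comm, Algebra.smul_def]
  have e1 := hsa (ξ + η)
  have e2 := hsa (ξ + Complex.I • η)
  simp only [h.add_left, map_add, star_add, hs, hs', map_smul, hsa, star_smul, RCLike.star_def,
    Complex.conj_I, map_neg] at e1 e2
  have e3 := congrArg (fun t => Complex.I • t) e2
  simp only [smul_add, smul_smul, neg_smul, smul_neg, neg_neg, neg_mul,
    Complex.I_mul_I] at e3
  generalize π (h.pair ξ η) = X at *
  generalize π (h.pair η ξ) = Y at *
  linear_combination (norm := module) (-(1 / 2) : ℂ) • e1 + (-(1 / 2) : ℂ) • e3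

theorem form_tmul_tmul (h : HermitianMetric π E) (ξ η : E) (ζ ζ' : H) :
    form h (tmul h ξ ζ) (tmul h η ζ') = ⟪ζ, π (h.pair ξ η) ζ'⟫_ℂ := by
  rw [form_tmul, contract_tmul, pair_conj h ξ η, ContinuousLinearMap.star_eq_adjoint]
  exact ContinuousLinearMap.adjoint_inner_left _ _ _

theorem form_add (h : HermitianMetric π E) (x y z : HilbertTensor h) :
    form h (x + y) z = form h x z + form h y z := by
  induction z using induction with
  | zero => simp
  | tm ξ ζ => simp [form_tmul]
  | add u v hu hv => simp only [map_add, hu, hv]; ring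

theorem form_smul (h : HermitianMetric π E) (c : ℂ) (x z : HilbertTensor h) :
    form h (c • x) z = (starRingEnd ℂ) c * form h x z := by
  induction z using induction with
  | zero => simp
  | tm ξ ζ => simp [form_tmul, mul_comm]
  | add u v hu hv => simp only [map_add, hu, hv]; ring

theorem form_conj (h : HermitianMetric π E) (x y : HilbertTensor h) :
    (starRingEnd ℂ) (form h y x) = form h x y := by
  have h0 : ∀ z, form h 0 z = 0 := fun z => by simpa using form_smul h 0 0 z
  induction x using induction with
  | zero => simp [h0]
  | tm ξ ζ =>
    induction y using induction with
    | zero => simp [h0]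
    | tm η ζ' => rw [form_tmul_tmul, form_tmul, contract_tmul, inner_conj_symm]
    | add u v hu hv => rw [form_add, map_add, map_add, hu, hv]
  | add u v hu hv => rw [form_add, map_add, map_add, hu, hv]

theorem form_nonneg (h : HermitianMetric π E) (x : HilbertTensor h) :
    0 ≤ RCLike.re (form h x x) := by
  obtain ⟨t, rfl⟩ := Submodule.mkQ_surjective (balanced π E) x
  obtain ⟨S, rfl⟩ := TensorProduct.exists_finset t
  have hx : (balanced π E).mkQ (∑ i ∈ S, i.1 ⊗ₜ[ℂ] i.2) =
      (∑ i : S, tmul h i.1.1 i.1.2 : HilbertTensor h) := by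
    rw [Finset.sum_coe_sort S (fun i => tmul h i.1 i.2)]
    exact map_sum (mk h) _ _
  rw [hx]
  have hsum : ∀ (y : S → HilbertTensor h) (z : HilbertTensor h),
      form h (∑ i, y i) z = ∑ i, form h (y i) z := by
    intro y z
    rw [← form_conj, map_sum, map_sum]
    exact Finset.sum_congr rfl fun i _ => form_conj h _ _
  simp only [hsum, map_sum (form h _), form_tmul_tmul]
  refine positive_aux π (fun i j : S => h.pair i.1.1 j.1.1) (fun i j => pair_conj h _ _) ?_
    (fun i : S => i.1.2)
  intro a
  have h1 : ∑ i : S, ∑ j : S, star (a i) * h.pair i.1.1 j.1.1 * a j =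
      h.pair (∑ i : S, MulOpposite.op (a i) • i.1.1) (∑ i : S, MulOpposite.op (a i) • i.1.1) := by
    let g : E →+ (E →ₗ[Aᵐᵒᵖ] A) :=
      AddMonoidHom.mk' h.pair fun x y => LinearMap.ext fun z => h.add_left x y z
    have hg : ∀ x, h.pair x = g x := fun _ => rfl
    rw [map_sum, hg, map_sum, Finset.sum_comm]
    refine Finset.sum_congr rfl fun j _ => ?_
    rw [LinearMap.sum_apply]
    refine Finset.sum_congr rfl fun i _ => ?_
    rw [← hg, h.smul_left, map_smul, op_smul_eq_mul, mul_assoc]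
  rw [h1]
  exact h.nonneg _

/-- A finite projective right module has a finite dual basis. -/
theorem exists_dual_basis (A E : Type*) [Ring A] [AddCommGroup E] [Module Aᵐᵒᵖ E]
    [Module.Finite Aᵐᵒᵖ E] [Module.Projective Aᵐᵒᵖ E] :
    ∃ (n : ℕ) (e : Fin n → E) (φ : Fin n → E →ₗ[Aᵐᵒᵖ] A),
      ∀ ξ, ξ = ∑ i, MulOpposite.op (φ i ξ) • e i := by
  obtain ⟨n, f, g, -, -, hfg⟩ := Module.Finite.exists_comp_eq_id_of_projective Aᵐᵒᵖ E
  refine ⟨n, fun i => f (Pi.single i 1), fun i =>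
    { toFun := fun ξ => (g ξ i).unop
      map_add' := by simp
      map_smul' := by intro a ξ; simp }, fun ξ => ?_⟩
  have h1 : f (g ξ) = ξ := LinearMap.congr_fun hfg ξ
  conv_lhs => rw [← h1]
  rw [LinearMap.pi_apply_eq_sum_univ f (g ξ)]
  refine Finset.sum_congr rfl fun i _ => ?_
  have h2 : (fun j => if i = j then (1 : Aᵐᵒᵖ) else 0) = Pi.single i 1 := by
    ext j
    simp [Pi.single_apply, eq_comm]
  rw [h2]
  rfl

theorem eq_sum_contract (h : HermitianMetric π E) {n : ℕ} {e : Fin n → E}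
    {φ : Fin n → E →ₗ[Aᵐᵒᵖ] A} (he : ∀ ξ, ξ = ∑ i, MulOpposite.op (φ i ξ) • e i)
    (x : HilbertTensor h) : x = ∑ i, tmul h (e i) (contract h (φ i) x) := by
  induction x using induction with
  | zero =>
    have : ∀ ξ, tmul h ξ 0 = 0 := fun ξ => by simpa using tmul_smul' h 0 ξ 0
    simp [this]
  | tm ξ ζ =>
    conv_lhs => rw [he ξ, sum_tmul]
    simp [tmul_smul]
  | add x y hx hy =>
    simp only [map_add, tmul_add, Finset.sum_add_distrib]
    rw [← hx, ← hy]

variable [Module.Finite Aᵐᵒᵖ E] [Module.Projective Aᵐᵒᵖ E]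

theorem form_definite (h : HermitianMetric π E) (x : HilbertTensor h) (hx : form h x x = 0) :
    x = 0 := by
  let c : PreInnerProductSpace.Core ℂ (HilbertTensor h) :=
    { inner := fun x y => form h x y
      conj_inner_symm := form_conj h
      re_inner_nonneg := form_nonneg h
      add_left := form_add h
      smul_left := fun x y r => form_smul h r x y }
  have h0 : ∀ y, form h x y = 0 := by
    intro y
    have h1 := @InnerProductSpace.Core.inner_mul_inner_self_le ℂ (HilbertTensor h) _ _ _ c x y
    change ‖form h x y‖ * ‖form h y x‖ ≤ RCLike.re (form h x x) * RCLike.re (form h y y) at h1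
    rw [← form_conj h y x, RCLike.norm_conj, hx, map_zero, zero_mul] at h1
    have := norm_nonneg (form h x y)
    exact norm_eq_zero.1 (by nlinarith)
  have h1 : ∀ φ, contract h φ x = 0 := by
    intro φ
    obtain ⟨η, rfl⟩ := h.bijective.2 φ
    have := h0 (tmul h η (contract h (h.pair η) x))
    rw [form_tmul] at this
    exact inner_self_eq_zero.1 this
  obtain ⟨n, e, φ, he⟩ := exists_dual_basis A E
  rw [eq_sum_contract h he x]
  have : ∀ ξ, tmul h ξ 0 = 0 := fun ξ => by simpa using tmul_smul' h 0 ξ 0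
  simp [h1, this]

/-- The inner product of `H(E)`. -/
@[reducible] noncomputable def core (h : HermitianMetric π E) : InnerProductSpace.Core ℂ (HilbertTensor h) where
  inner := fun x y => form h x y
  conj_inner_symm := form_conj h
  re_inner_nonneg := form_nonneg h
  add_left := form_add h
  smul_left := fun x y r => form_smul h r x y
  definite := form_definite h

noncomputable instance (h : HermitianMetric π E) : NormedAddCommGroup (HilbertTensor h) :=
  (core h).toNormedAddCommGroup

noncomputable instance (h : HermitianMetric π E) : InnerProductSpace ℂ (HilbertTensor h) :=
  InnerProductSpace.ofCore (core h).toCore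

theorem inner_eq_form (h : HermitianMetric π E) (x y : HilbertTensor h) :
    ⟪x, y⟫_ℂ = form h x y := rfl

/-- The defining formula of the inner product of `H(E)`. -/
theorem inner_tmul_tmul (h : HermitianMetric π E) (ξ η : E) (ζ ζ' : H) :
    ⟪tmul h ξ ζ, tmul h η ζ'⟫_ℂ = ⟪ζ, π (h.pair ξ η) ζ'⟫_ℂ :=
  form_tmul_tmul h ξ η ζ ζ'

theorem norm_tmul_le (h : HermitianMetric π E) (ξ : E) (ζ : H) :
    ‖tmul h ξ ζ‖ ≤ √‖π (h.pair ξ ξ)‖ * ‖ζ‖ := by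
  have h1 : ‖tmul h ξ ζ‖ ^ 2 ≤ ‖π (h.pair ξ ξ)‖ * ‖ζ‖ ^ 2 := by
    rw [← inner_self_eq_norm_sq (𝕜 := ℂ), inner_tmul_tmul]
    calc RCLike.re ⟪ζ, π (h.pair ξ ξ) ζ⟫_ℂ ≤ ‖ζ‖ * ‖π (h.pair ξ ξ) ζ‖ := re_inner_le_norm _ _
      _ ≤ ‖ζ‖ * (‖π (h.pair ξ ξ)‖ * ‖ζ‖) := by gcongr; exact ContinuousLinearMap.le_opNorm _ _
      _ = _ := by ring
  refine le_of_sq_le_sq ?_ (by positivity)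
  rw [mul_pow, Real.sq_sqrt (norm_nonneg _)]
  exact h1

theorem exists_norm_contract_le (h : HermitianMetric π E) (φ : E →ₗ[Aᵐᵒᵖ] A) :
    ∃ C, ∀ x : HilbertTensor h, ‖contract h φ x‖ ≤ C * ‖x‖ := by
  obtain ⟨η, rfl⟩ := h.bijective.2 φ
  refine ⟨√‖π (h.pair η η)‖, fun x => ?_⟩
  have h1 : ‖contract h (h.pair η) x‖ ^ 2 ≤
      √‖π (h.pair η η)‖ * ‖x‖ * ‖contract h (h.pair η) x‖ := by
    rw [← inner_self_eq_norm_sq (𝕜 := ℂ), ← form_tmul, ← inner_eq_form]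
    calc _ ≤ ‖x‖ * ‖tmul h η (contract h (h.pair η) x)‖ := re_inner_le_norm _ _
      _ ≤ ‖x‖ * (√‖π (h.pair η η)‖ * ‖contract h (h.pair η) x‖) := by
        gcongr; exact norm_tmul_le h _ _
      _ = _ := by ring
  rcases (norm_nonneg (contract h (h.pair η) x)).eq_or_lt with h0 | h0
  · rw [← h0]; positivity
  · rw [sq] at h1
    exact le_of_mul_le_mul_right h1 h0

/-- `H(E)` is complete: no completion is needed, since `E` is finitely generated projective. -/
instance (h : HermitianMetric π E) : CompleteSpace (HilbertTensor h) := by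
  obtain ⟨n, e, φ, he⟩ := exists_dual_basis A E
  choose C hC using fun i => exists_norm_contract_le h (φ i)
  let L : Fin n → HilbertTensor h →L[ℂ] H := fun i => (contract h (φ i)).mkContinuous (C i) (hC i)
  let J : Fin n → H →L[ℂ] HilbertTensor h := fun i =>
    LinearMap.mkContinuous
      { toFun := tmul h (e i)
        map_add' := tmul_add h (e i)
        map_smul' := fun c z => tmul_smul' h c (e i) z } _ (norm_tmul_le h (e i))
  have hJL : ∀ x, x = ∑ i, J i (L i x) := eq_sum_contract h he
  refine Metric.complete_of_cauchySeq_tendsto fun u hu => ?_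
  have h1 : ∀ i, ∃ y, Filter.Tendsto (fun k => L i (u k)) Filter.atTop (nhds y) := fun i =>
    cauchySeq_tendsto_of_complete (hu.map (L i).uniformContinuous)
  choose y hy using h1
  refine ⟨∑ i, J i (y i), ?_⟩
  have h2 : u = fun k => ∑ i, J i (L i (u k)) := funext fun k => hJL (u k)
  rw [h2]
  exact tendsto_finsetSum _ fun i _ => ((J i).continuous.tendsto _).comp (hy i)

end HilbertTensor
end HilbertTensor

section UnboundedOperators

variable {V W : Type*} [NormedAddCommGroup V] [InnerProductSpace ℂ V]
  [NormedAddCommGroup W] [InnerProductSpace ℂ W]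

/-- The resolvent `(B + i)⁻¹` of the unbounded operator `B` exists as an everywhere defined bounded
operator, and it is compact. -/
def HasCompactResolvent (B : V →ₗ.[ℂ] V) : Prop :=
  ∃ R : V →L[ℂ] V, IsCompactOperator R ∧
    (∀ x : V, ∃ y : B.domain, (y : V) = R x ∧ B y + Complex.I • (y : V) = x) ∧
    ∀ y : B.domain, R (B y + Complex.I • (y : V)) = y

/-- A (possibly unbounded) operator is Fredholm if it is closed, its kernel is finite-dimensional
and its range is closed and has finite codimension. -/
structure IsFredholm (T : V →ₗ.[ℂ] W) : Prop where
  isClosed : T.IsClosed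
  finite_ker : FiniteDimensional ℂ (LinearMap.ker T.toFun)
  isClosed_range : IsClosed (LinearMap.range T.toFun : Set W)
  finite_coker : FiniteDimensional ℂ (W ⧸ LinearMap.range T.toFun)

/-- The eigenspace `{x ∈ dom B | B x = z x}`; its dimension is the multiplicity of `z`. -/
def eigenspace (B : V →ₗ.[ℂ] V) (z : ℂ) : Submodule ℂ V :=
  (LinearMap.ker (B.toFun - z • B.domain.subtype)).map B.domain.subtype

/-- The indices `j = 1, 2, …`, up to the dimension of `V` (so all `j ≥ 1` when `V` is
infinite-dimensional). -/
def indices (V : Type*) [AddCommGroup V] [Module ℂ V] : Set ℕ :=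
  {j | 1 ≤ j ∧ (j : Cardinal) ≤ Module.rank ℂ V}

/-- `lam 1, lam 2, …` is an arrangement of all the eigenvalues of `B` (which therefore are real and
have finite multiplicity), each repeated according to its multiplicity, with
`|lam 1| ≤ |lam 2| ≤ ⋯`. -/
structure IsEigenvalueSequence (B : V →ₗ.[ℂ] V) (lam : ℕ → ℝ) : Prop where
  abs_le : ∀ i ∈ indices V, ∀ j ∈ indices V, i ≤ j → |lam i| ≤ |lam j|
  finite_multiplicity : ∀ z : ℂ, FiniteDimensional ℂ (eigenspace B z)
  multiplicity : ∀ z : ℂ,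
    {j ∈ indices V | (lam j : ℂ) = z}.encard = Module.finrank ℂ (eigenspace B z)

/-- The composition `B ∘ C` of unbounded operators, on its natural domain
`{x ∈ dom C | C x ∈ dom B}`. -/
def composition {X : Type*} [AddCommGroup X] [Module ℂ X] (B : W →ₗ.[ℂ] X) (C : V →ₗ.[ℂ] W) :
    V →ₗ.[ℂ] X :=
  B.comp (C.domRestrict ((B.domain.comap C.toFun).map C.domain.subtype)) (by
    rintro ⟨x, ⟨⟨y, hy, rfl⟩, hx⟩⟩
    exact hy)

/-- `P` is the absolute value `|T| = √(T* T)`, i.e. the nonnegative selfadjoint operator such that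
`P² = T* T`. -/
structure IsOperatorAbs [CompleteSpace V] (T : V →ₗ.[ℂ] W) (P : V →ₗ.[ℂ] V) : Prop where
  isSelfAdjoint : IsSelfAdjoint P
  nonneg : ∀ x : P.domain, 0 ≤ RCLike.re ⟪(x : V), P x⟫_ℂ
  sq_eq : composition P P = composition T.adjoint T

end UnboundedOperators

section TwistedSpectralTriples

set_option linter.unusedSectionVars false

/-- A twisted spectral triple `(A, H, D)_σ`. -/
structure TwistedSpectralTriple (A H : Type*) [Ring A] [StarRing A] [Algebra ℂ A]
    [StarModule ℂ A] [NormedAddCommGroup H] [InnerProductSpace ℂ H] [CompleteSpace H] where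
  /-- The summand `H⁺` of the `ℤ₂`-graded Hilbert space `H = H⁺ ⊕ H⁻`, where `H⁻ = (H⁺)ᗮ`. -/
  Hplus : Submodule ℂ H
  isClosed_Hplus : IsClosed (Hplus : Set H)
  /-- The unital representation of the involutive algebra `A`, by even bounded operators. -/
  π : A →⋆ₐ[ℂ] (H →L[ℂ] H)
  even_plus : ∀ a : A, ∀ x ∈ Hplus, π a x ∈ Hplus
  even_minus : ∀ a : A, ∀ x ∈ Hplusᗮ, π a x ∈ Hplusᗮ
  σ : A ≃ₐ[ℂ] A
  star_σ : ∀ a : A, star (σ a) = σ.symm (star a)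
  D : H →ₗ.[ℂ] H
  isSelfAdjoint_D : IsSelfAdjoint D
  /-- `D` is odd: its domain is graded and `D` exchanges the two parities. -/
  graded_domain : ∀ x ∈ D.domain, ∃ y ∈ D.domain, y ∈ Hplus ∧ x - y ∈ Hplusᗮ
  odd_plus : ∀ x : D.domain, (x : H) ∈ Hplus → D x ∈ Hplusᗮ
  odd_minus : ∀ x : D.domain, (x : H) ∈ Hplusᗮ → D x ∈ Hplus
  compact_resolvent : HasCompactResolvent D
  domain_invariant : ∀ a : A, ∀ x ∈ D.domain, π a x ∈ D.domain
  bounded_commutator : ∀ a : A, ∃ C : ℝ, ∀ x : D.domain,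
    ‖D ⟨π a x, domain_invariant a x x.2⟩ - π (σ a) (D x)‖ ≤ C * ‖(x : H)‖

/-- The map `σ^E : E → E^σ` of a `σ`-translation `(E^σ, σ^E)` of `E`: a `ℂ`-linear isomorphism such
that `σ^E (ξ a) = σ^E(ξ) σ(a)`. -/
structure SigmaTranslation {A : Type*} [Ring A] [Algebra ℂ A] (σ : A ≃ₐ[ℂ] A)
    (E Eσ : Type*) [AddCommGroup E] [Module ℂ E] [Module Aᵐᵒᵖ E]
    [AddCommGroup Eσ] [Module ℂ Eσ] [Module Aᵐᵒᵖ Eσ] where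
  toEquiv : E ≃ₗ[ℂ] Eσ
  map_smul : ∀ (ξ : E) (a : A),
    toEquiv (MulOpposite.op a • ξ) = MulOpposite.op (σ a) • toEquiv ξ

variable {A H : Type*} [Ring A] [StarRing A] [Algebra ℂ A] [StarModule ℂ A]
  [NormedAddCommGroup H] [InnerProductSpace ℂ H] [CompleteSpace H]
  {𝒯 : TwistedSpectralTriple A H}
  {E Eσ : Type*} [AddCommGroup E] [Module ℂ E] [Module Aᵐᵒᵖ E] [IsScalarTower ℂ Aᵐᵒᵖ E]
  [Module.Finite Aᵐᵒᵖ E] [Module.Projective Aᵐᵒᵖ E]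
  [AddCommGroup Eσ] [Module ℂ Eσ] [Module Aᵐᵒᵖ Eσ] [IsScalarTower ℂ Aᵐᵒᵖ Eσ]
  [Module.Finite Aᵐᵒᵖ Eσ] [Module.Projective Aᵐᵒᵖ Eσ]
  {τ : SigmaTranslation 𝒯.σ E Eσ}

/-- A `σ`-Hermitian structure on `E`, for the `σ`-translation `τ = (E^σ, σ^E)`: a Hermitian metric
and a right-module isomorphism `𝔰 : E^σ → E` such that
`(ξ₁, 𝔰(σ^E ξ₂)) = σ[(𝔰(σ^E ξ₁), ξ₂)]`. -/
structure SigmaHermitianStructure (𝒯 : TwistedSpectralTriple A H) {E Eσ : Type*}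
    [AddCommGroup E] [Module ℂ E] [Module Aᵐᵒᵖ E]
    [AddCommGroup Eσ] [Module ℂ Eσ] [Module Aᵐᵒᵖ Eσ] (τ : SigmaTranslation 𝒯.σ E Eσ) where
  metric : HermitianMetric 𝒯.π E
  s : Eσ ≃ₗ[Aᵐᵒᵖ] E
  compat : ∀ ξ₁ ξ₂ : E,
    metric.pair ξ₁ (s (τ.toEquiv ξ₂)) = 𝒯.σ (metric.pair (s (τ.toEquiv ξ₁)) ξ₂)

namespace SigmaHermitianStructure

/-- The Hermitian metric `(η₁, η₂) ↦ (𝔰 η₁, 𝔰 η₂)` of `E^σ`. -/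
def metricσ (𝔥 : SigmaHermitianStructure 𝒯 τ) : HermitianMetric 𝒯.π Eσ where
  pair := fun η => 𝔥.metric.pair (𝔥.s η) ∘ₗ 𝔥.s.toLinearMap
  add_left := by simp [𝔥.metric.add_left]
  smul_left := by simp [𝔥.metric.smul_left]
  nonneg := fun η => 𝔥.metric.nonneg (𝔥.s η)
  bijective := by
    have h1 : Function.Bijective
        (fun φ : E →ₗ[Aᵐᵒᵖ] A => φ ∘ₗ 𝔥.s.toLinearMap) := by
      refine ⟨fun φ ψ h => ?_, fun φ => ⟨φ ∘ₗ 𝔥.s.symm.toLinearMap, ?_⟩⟩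
      · ext ξ
        simpa using LinearMap.congr_fun h (𝔥.s.symm ξ)
      · ext ξ
        simp
    exact h1.comp (𝔥.metric.bijective.comp 𝔥.s.bijective)

/-- The Hilbert space `H(E)`. -/
abbrev HE (𝔥 : SigmaHermitianStructure 𝒯 τ) : Type _ := HilbertTensor 𝔥.metric

/-- The Hilbert space `H(E^σ)`. -/
abbrev HEσ (𝔥 : SigmaHermitianStructure 𝒯 τ) : Type _ := HilbertTensor 𝔥.metricσ

open HilbertTensor

theorem s_smul (𝔥 : SigmaHermitianStructure 𝒯 τ) (c : ℂ) (η : Eσ) :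
    𝔥.s (c • η) = c • 𝔥.s η :=
  (𝔥.s.toLinearMap.restrictScalars ℂ).map_smul c η

theorem s_symm_smul (𝔥 : SigmaHermitianStructure 𝒯 τ) (c : ℂ) (ξ : E) :
    𝔥.s.symm (c • ξ) = c • 𝔥.s.symm ξ :=
  (𝔥.s.symm.toLinearMap.restrictScalars ℂ).map_smul c ξ

/-- The map `𝔰 ⊗ 1`. -/
noncomputable def sTensorMap (𝔥 : SigmaHermitianStructure 𝒯 τ) : 𝔥.HEσ →ₗ[ℂ] 𝔥.HE :=
  lift 𝔥.metricσ (LinearMap.mk₂ ℂ (fun η ζ => tmul 𝔥.metric (𝔥.s η) ζ)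
    (by simp [add_tmul]) (by simp [s_smul, smul_tmul]) (by simp [tmul_add])
    (by simp [tmul_smul']))
    (by intro η a ζ; simp [tmul_smul])

theorem sTensorMap_tmul (𝔥 : SigmaHermitianStructure 𝒯 τ) (η : Eσ) (ζ : H) :
    𝔥.sTensorMap (tmul 𝔥.metricσ η ζ) = tmul 𝔥.metric (𝔥.s η) ζ :=
  (lift_tmul _ _ _ _ _).trans rfl

/-- The map `𝔰⁻¹ ⊗ 1`. -/
noncomputable def sTensorInv (𝔥 : SigmaHermitianStructure 𝒯 τ) : 𝔥.HE →ₗ[ℂ] 𝔥.HEσ :=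
  lift 𝔥.metric (LinearMap.mk₂ ℂ (fun ξ ζ => tmul 𝔥.metricσ (𝔥.s.symm ξ) ζ)
    (by simp [add_tmul]) (by simp [s_symm_smul, smul_tmul]) (by simp [tmul_add])
    (by simp [tmul_smul']))
    (by intro η a ζ; simp [tmul_smul])

theorem sTensorInv_tmul (𝔥 : SigmaHermitianStructure 𝒯 τ) (ξ : E) (ζ : H) :
    𝔥.sTensorInv (tmul 𝔥.metric ξ ζ) = tmul 𝔥.metricσ (𝔥.s.symm ξ) ζ :=
  (lift_tmul _ _ _ _ _).trans rfl

theorem sTensorMap_inner (𝔥 : SigmaHermitianStructure 𝒯 τ) (x y : 𝔥.HEσ) :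
    ⟪𝔥.sTensorMap x, 𝔥.sTensorMap y⟫_ℂ = ⟪x, y⟫_ℂ := by
  induction x using induction with
  | zero => simp
  | tm η ζ =>
    induction y using induction with
    | zero => simp
    | tm η' ζ' =>
      rw [sTensorMap_tmul, sTensorMap_tmul, inner_tmul_tmul, inner_tmul_tmul]
      rfl
    | add u v hu hv => rw [map_add, inner_add_right, inner_add_right, hu, hv]
  | add u v hu hv => rw [map_add, inner_add_left, inner_add_left, hu, hv]

/-- The unitary operator `𝔰 ⊗ 1` from `H(E^σ)` onto `H(E)`. -/
noncomputable def S (𝔥 : SigmaHermitianStructure 𝒯 τ) : 𝔥.HEσ ≃ₗᵢ[ℂ] 𝔥.HE :=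
  LinearEquiv.isometryOfInner
    (LinearEquiv.ofLinearMap 𝔥.sTensorMap 𝔥.sTensorInv
      (by
        refine LinearMap.ext fun x => ?_
        induction x using induction with
        | zero => simp
        | tm ξ ζ =>
          rw [LinearMap.comp_apply, sTensorInv_tmul, sTensorMap_tmul, LinearEquiv.apply_symm_apply]
          rfl
        | add u v hu hv => rw [map_add, hu, hv, map_add])
      (by
        refine LinearMap.ext fun x => ?_
        induction x using induction with
        | zero => simp
        | tm ξ ζ =>
          rw [LinearMap.comp_apply, sTensorMap_tmul, sTensorInv_tmul, LinearEquiv.symm_apply_apply]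
          rfl
        | add u v hu hv => rw [map_add, hu, hv, map_add]))
    (fun x y => 𝔥.sTensorMap_inner x y)

theorem S_tmul (𝔥 : SigmaHermitianStructure 𝒯 τ) (η : Eσ) (ζ : H) :
    𝔥.S (tmul 𝔥.metricσ η ζ) = tmul 𝔥.metric (𝔥.s η) ζ :=
  𝔥.sTensorMap_tmul η ζ

/-- The pairing `σ⟨ζ^σ, ζ⟩ = ⟨(𝔰 ⊗ 1) ζ^σ, ζ⟩` on `H(E^σ) × H(E)`. -/
noncomputable def leftPairing (𝔥 : SigmaHermitianStructure 𝒯 τ) (y : 𝔥.HEσ) (x : 𝔥.HE) : ℂ :=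
  ⟪𝔥.S y, x⟫_ℂ

/-- The pairing `⟨ζ, ζ^σ⟩σ = ⟨ζ, (𝔰 ⊗ 1) ζ^σ⟩` on `H(E) × H(E^σ)`. -/
noncomputable def rightPairing (𝔥 : SigmaHermitianStructure 𝒯 τ) (x : 𝔥.HE) (y : 𝔥.HEσ) : ℂ :=
  ⟪x, 𝔥.S y⟫_ℂ

/-- The graph of the `𝔰`-adjoint of `T`. -/
noncomputable def sAdjointGraph (𝔥 : SigmaHermitianStructure 𝒯 τ) (T : 𝔥.HE →ₗ.[ℂ] 𝔥.HEσ) :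
    Submodule ℂ (𝔥.HE × 𝔥.HEσ) where
  carrier := {p | ∀ z : T.domain, 𝔥.rightPairing p.1 (T z) = 𝔥.leftPairing p.2 z}
  add_mem' := by
    intro p q hp hq z
    have h1 := hp z
    have h2 := hq z
    simp only [leftPairing, rightPairing] at h1 h2 ⊢
    simp [h1, h2]
  zero_mem' := by
    intro z
    simp [leftPairing, rightPairing]
  smul_mem' := by
    intro c p hp z
    have h1 := hp z
    simp only [leftPairing, rightPairing] at h1 ⊢
    simp [h1]

/-- The `𝔰`-adjoint `T†` of a densely defined operator `T`; see `sAdjoint_graph`. -/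
noncomputable def sAdjoint (𝔥 : SigmaHermitianStructure 𝒯 τ) (T : 𝔥.HE →ₗ.[ℂ] 𝔥.HEσ) :
    𝔥.HE →ₗ.[ℂ] 𝔥.HEσ :=
  (𝔥.sAdjointGraph T).toLinearPMap

theorem sAdjoint_graph (𝔥 : SigmaHermitianStructure 𝒯 τ) (T : 𝔥.HE →ₗ.[ℂ] 𝔥.HEσ)
    (hT : Dense (T.domain : Set 𝔥.HE)) : (𝔥.sAdjoint T).graph = 𝔥.sAdjointGraph T := by
  refine Submodule.toLinearPMap_graph_eq _ fun p hp h0 => ?_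
  have h1 : 𝔥.S p.2 = 0 := by
    refine hT.eq_zero_of_inner_left (𝕜 := ℂ) fun v hv => ?_
    have := hp ⟨v, hv⟩
    simp only [leftPairing, rightPairing, h0, inner_zero_left] at this
    exact this.symm
  exact (map_eq_zero_iff 𝔥.S 𝔥.S.injective).1 h1

/-- `T` is `𝔰`-selfadjoint if `T = T†`. -/
def IsSSelfAdjoint (𝔥 : SigmaHermitianStructure 𝒯 τ) (T : 𝔥.HE →ₗ.[ℂ] 𝔥.HEσ) : Prop :=
  T = 𝔥.sAdjoint T

/-- The operator `(𝔰 ⊗ 1) T` of `H(E)`, with domain `dom T`.  Its eigenvalues are the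
`𝔰`-eigenvalues of `T`. -/
noncomputable def sComp (𝔥 : SigmaHermitianStructure 𝒯 τ) (T : 𝔥.HE →ₗ.[ℂ] 𝔥.HEσ) :
    𝔥.HE →ₗ.[ℂ] 𝔥.HE :=
  (𝔥.S.toLinearEquiv : 𝔥.HEσ →ₗ[ℂ] 𝔥.HE).compPMap T

end SigmaHermitianStructure

end TwistedSpectralTriples

end TwistedGeometry

open TwistedGeometry

/-! Since S is unitary, everything reduces to the single operator B = ST on H(E). The equation T =
T† says exactly that B is selfadjoint (`isSelfAdjoint_sComp`); moreover T*T = B²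
(`adjoint_composition_self`) and ‖Tζ‖ = ‖Bζ‖. What remains is spectral theory for a selfadjoint B
with compact resolvent R = (B + i)⁻¹.

R is compact, normal and injective, so the eigenvectors of B are total
(`orthogonal_iSup_eigenspace`); compactness leaves only finitely many orthonormal eigenvectors with
eigenvalues in a bounded range (`finite_of_orthonormal_of_bounded`). Hence there is a Hilbert basis
of eigenvectors, which can be listed by increasing |λ|.

|T| exists as JB, with J the sign of B (`exists_isOperatorAbs`). Conversely, for any nonnegative
selfadjoint P with P² = B² and any t ≥ 0, the t-eigenspace of P is the sum of the ±t-eigenspaces of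
B (`IsOperatorAbs.eigenspace_eq`). So the |λ_j| arrange the eigenvalues of P, and as a nondecreasing
arrangement is unique, |λ_j| = μ_j.

The min-max formula comes from ‖Bx‖² = ∑ λ_i² |⟨b_i, x⟩|²: for dim F = j − 1, the span of b_1, …,
b_j meets Fᗮ, and F = span(b_1, …, b_{j−1}) is optimal.

Unbounded operators are compared through their graphs, which keeps track of domains automatically.
-/

namespace TwistedGeometry

/-! ### Selfadjoint operators with compact resolvent: totality of eigenvectors. -/

section SpectralTheory

variable {V : Type*} [NormedAddCommGroup V] [InnerProductSpace ℂ V] {B : V →ₗ.[ℂ] V}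

theorem mem_eigenspace_iff {z : ℂ} {x : V} : x ∈ eigenspace B z ↔ (x, z • x) ∈ B.graph := by
  simp only [eigenspace, Submodule.mem_map, LinearMap.mem_ker, LinearPMap.mem_graph_iff]
  constructor
  · rintro ⟨y, hy, rfl⟩
    exact ⟨y, rfl, by simpa [sub_eq_zero] using hy⟩
  · rintro ⟨y, rfl, hy⟩
    exact ⟨y, by simpa [sub_eq_zero] using hy, rfl⟩

/-- Bx = y is the same as (B + i)x = y + ix, so R alone determines the graph of B, domain included.
-/
theorem HasCompactResolvent.exists_graph_iff (h : HasCompactResolvent B) :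
    ∃ R : V →L[ℂ] V, IsCompactOperator R ∧
      ∀ x y, (x, y) ∈ B.graph ↔ R (y + Complex.I • x) = x := by
  obtain ⟨R, hR, h1, h2⟩ := h
  refine ⟨R, hR, fun x y => ?_⟩
  rw [LinearPMap.mem_graph_iff]
  constructor
  · rintro ⟨u, rfl, rfl⟩
    exact h2 u
  · intro hx
    obtain ⟨u, hu, hu'⟩ := h1 (y + Complex.I • x)
    rw [hx] at hu
    refine ⟨u, hu, ?_⟩
    dsimp only at *
    rw [hu] at hu'
    exact add_right_cancel hu'

/-- Bx = zx gives (z + i)Rx = x: either z = −i and x = 0, or x is an eigenvector of the compact R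
for a nonzero value. -/
theorem finiteDimensional_eigenspace [CompleteSpace V] (h : HasCompactResolvent B) (z : ℂ) :
    FiniteDimensional ℂ (eigenspace B z) := by
  obtain ⟨R, hR, hg⟩ := h.exists_graph_iff
  have hx : ∀ x ∈ eigenspace B z, (z + Complex.I) • R x = x := fun x hx => by
    rw [← map_smul, add_smul]
    exact (hg _ _).1 (mem_eigenspace_iff.1 hx)
  by_cases hz : z + Complex.I = 0
  · have : eigenspace B z = ⊥ := (Submodule.eq_bot_iff _).2 fun x h => by
      rw [← hx x h, hz, zero_smul]
    rw [this]
    infer_instance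
  · have := ContinuousLinearMap.finite_dimensional_eigenspace hR _ (inv_ne_zero hz)
    refine Submodule.finiteDimensional_of_le
      (S₂ := Module.End.eigenspace R.toLinearMap (z + Complex.I)⁻¹) fun x h => ?_
    rw [Module.End.mem_eigenspace_iff]
    exact (eq_inv_smul_iff₀ hz).2 (hx x h)

variable [CompleteSpace V]

/-- This is B = B* read on graphs. Beyond symmetry, the reverse implication is a test for membership
in dom B. -/
theorem mem_graph_iff_forall_inner (hB : IsSelfAdjoint B) {x y : V} :
    (x, y) ∈ B.graph ↔ ∀ a b, (a, b) ∈ B.graph → ⟪b, x⟫_ℂ = ⟪a, y⟫_ℂ := by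
  have h1 := LinearPMap.adjoint_graph_eq_graph_adjoint hB.dense_domain
  rw [LinearPMap.isSelfAdjoint_def.1 hB] at h1
  conv_lhs => rw [h1]
  simp [sub_eq_zero]

theorem inner_eq_of_mem_graph (hB : IsSelfAdjoint B) {x y a b : V} (h : (x, y) ∈ B.graph)
    (h' : (a, b) ∈ B.graph) : ⟪b, x⟫_ℂ = ⟪a, y⟫_ℂ :=
  (mem_graph_iff_forall_inner hB).1 h _ _ h'

theorem conj_eq_of_mem_eigenspace (hB : IsSelfAdjoint B) {z : ℂ} {x : V}
    (hx : x ∈ eigenspace B z) (h0 : x ≠ 0) : (starRingEnd ℂ) z = z := by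
  have hg := mem_eigenspace_iff.1 hx
  have := inner_eq_of_mem_graph hB hg hg
  rw [inner_smul_left, inner_smul_right] at this
  exact mul_right_cancel₀ (inner_self_ne_zero.2 h0) this

theorem inner_eq_zero_of_mem_eigenspace (hB : IsSelfAdjoint B) {s t : ℝ} (hst : s ≠ t) {x y : V}
    (hx : x ∈ eigenspace B s) (hy : y ∈ eigenspace B t) : ⟪x, y⟫_ℂ = 0 := by
  have := inner_eq_of_mem_graph hB (mem_eigenspace_iff.1 hy) (mem_eigenspace_iff.1 hx)
  rw [inner_smul_left, inner_smul_right, Complex.conj_ofReal] at this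
  by_contra h0
  exact hst (by exact_mod_cast mul_right_cancel₀ h0 this)

/-- The adjoint of (B + i)⁻¹ is (B − i)⁻¹, because B is selfadjoint. -/
theorem adjoint_resolvent_apply (hB : IsSelfAdjoint B) {R : V →L[ℂ] V}
    (hg : ∀ x y, (x, y) ∈ B.graph ↔ R (y + Complex.I • x) = x) {x y : V}
    (h : (x, y) ∈ B.graph) : R.adjoint (y - Complex.I • x) = x := by
  refine ext_inner_right ℂ fun u => ?_
  have hu : (R u, u - Complex.I • R u) ∈ B.graph := by simp [hg]
  have := inner_eq_of_mem_graph hB hu h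
  rw [inner_sub_right, inner_smul_right] at this
  rw [ContinuousLinearMap.adjoint_inner_left, inner_sub_left, inner_smul_left, this,
    Complex.conj_I]
  ring

/-- R is normal by the resolvent identity, used in both orders: R* − R = 2i RR* and R* − R = 2i R*R.
-/
theorem resolvent_comp_adjoint (hB : IsSelfAdjoint B) {R : V →L[ℂ] V}
    (hg : ∀ x y, (x, y) ∈ B.graph ↔ R (y + Complex.I • x) = x) (x : V) :
    R (R.adjoint x) = R.adjoint (R x) := by
  have h1 : (R.adjoint x, x + Complex.I • R.adjoint x) ∈ B.graph := by
    rw [mem_graph_iff_forall_inner hB]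
    intro a b hab
    have ha := (hg _ _).1 hab
    have ha' : ⟪a, x⟫_ℂ = ⟪R b, x⟫_ℂ - Complex.I * ⟪R a, x⟫_ℂ := by
      conv_lhs => rw [← ha]
      rw [map_add, map_smul, inner_add_left, inner_smul_left, Complex.conj_I]
      ring
    rw [ContinuousLinearMap.adjoint_inner_right, inner_add_right, inner_smul_right,
      ContinuousLinearMap.adjoint_inner_right, ha']
    ring
  have h2 : (R x, x - Complex.I • R x) ∈ B.graph := by simp [hg]
  have e1 := (hg _ _).1 h1
  have e2 := adjoint_resolvent_apply hB hg h2
  simp only [map_add, map_sub, map_smul] at e1 e2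
  have h3 : (2 * Complex.I) • (R (R.adjoint x) - R.adjoint (R x)) = 0 := by
    linear_combination (norm := module) e1 + e2
  simpa [sub_eq_zero] using h3

/-- The eigenvectors of a selfadjoint operator with compact resolvent are total. -/
theorem orthogonal_iSup_eigenspace (hB : IsSelfAdjoint B) (hc : HasCompactResolvent B) :
    (⨆ z, eigenspace B z)ᗮ = ⊥ := by
  obtain ⟨R, hR, hg⟩ := hc.exists_graph_iff
  have hmem : ∀ x : V, x ∈ (⨆ z, eigenspace B z)ᗮ ↔
      ∀ z, ∀ e ∈ eigenspace B z, ⟪e, x⟫_ℂ = 0 := fun x => by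
    rw [← Submodule.iInf_orthogonal, Submodule.mem_iInf]
    rfl
  set W := (⨆ z, eigenspace B z)ᗮ with hW
  -- The eigenvector relation is kept in the form d N e = e to cover d = 0 (that is, z = ±i), where
  -- it forces e = 0.
  have haux : ∀ (N : V →L[ℂ] V) {d : ℂ} {e x : V}, d • N e = e → ⟪e, x⟫_ℂ = 0 →
      ⟪N e, x⟫_ℂ = 0 := fun N d e x h h0 => by
    by_cases hd : d = 0
    · rw [hd, zero_smul] at h
      simp [← h]
    · rw [← h, inner_smul_left] at h0
      simpa [hd] using h0
  have hRW : ∀ x ∈ W, R x ∈ W := fun x hx => (hmem _).2 fun z e he => by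
    have h1 := adjoint_resolvent_apply hB hg (mem_eigenspace_iff.1 he)
    rw [← sub_smul, map_smul] at h1
    rw [← ContinuousLinearMap.adjoint_inner_left]
    exact haux _ h1 ((hmem _).1 hx z e he)
  have hRaW : ∀ x ∈ W, R.adjoint x ∈ W := fun x hx => (hmem _).2 fun z e he => by
    have h1 := (hg _ _).1 (mem_eigenspace_iff.1 he)
    rw [← add_smul, map_smul] at h1
    rw [ContinuousLinearMap.adjoint_inner_right]
    exact haux _ h1 ((hmem _).1 hx z e he)
  have hinj : ∀ x, R x = 0 → x = 0 := fun x hx => by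
    have : ((0 : V), x) ∈ B.graph := by simp [hg, hx]
    exact B.graph_fst_eq_zero_snd this rfl
  -- R is only normal, so the spectral theorem for compact symmetric operators is applied to R*R on
  -- W. It is nonzero if W ≠ 0, since R is injective.
  have hKW : ∀ x ∈ W, (R.adjoint ∘L R) x ∈ W := fun x hx => hRaW _ (hRW _ hx)
  let K : W →L[ℂ] W := (R.adjoint ∘L R).restrict hKW
  have hK : IsCompactOperator K := (hR.clm_comp R.adjoint).restrict' hKW
  have hKs : K.IsSymmetric := by
    intro x y
    change ⟪R.adjoint (R x), (y : V)⟫_ℂ = ⟪(x : V), R.adjoint (R y)⟫_ℂ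
    rw [ContinuousLinearMap.adjoint_inner_left, ContinuousLinearMap.adjoint_inner_right]
  by_contra hne
  have hK0 : K ≠ 0 := by
    intro h0
    refine hne ((Submodule.eq_bot_iff _).2 fun x hx => hinj _ ?_)
    have h1 : R.adjoint (R x) = 0 := congrArg Subtype.val (congrArg (fun N => N ⟨x, hx⟩) h0)
    rw [← inner_self_eq_zero (𝕜 := ℂ), ← ContinuousLinearMap.adjoint_inner_right, h1,
      inner_zero_right]
  have h1 := (ContinuousLinearMap.eq_zero_of_forall_hasEigenvalue_eq_zero hK hKs).not.2 hK0
  push Not at h1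
  obtain ⟨μ, hμ, hμ0⟩ := h1
  have := ContinuousLinearMap.finite_dimensional_eigenspace hK μ hμ0
  -- By normality R preserves the finite-dimensional μ-eigenspace of R*R, hence has an eigenvector v
  -- there. From Rv = cv follows Bv = (c⁻¹ − i)v, although v in W is orthogonal to all eigenvectors
  -- of B.
  let r : Module.End ℂ W := R.toLinearMap.restrict hRW
  have hcomm : Commute K.toLinearMap r := by
    refine LinearMap.ext fun x => Subtype.ext ?_
    change R.adjoint (R (R x)) = R (R.adjoint (R x))
    rw [resolvent_comp_adjoint hB hg]
  have hmaps : ∀ x ∈ Module.End.eigenspace K.toLinearMap μ,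
      r x ∈ Module.End.eigenspace K.toLinearMap μ :=
    Module.End.mapsTo_genEigenspace_of_comm hcomm μ 1
  have hnt : Nontrivial (Module.End.eigenspace K.toLinearMap μ) :=
    Submodule.nontrivial_iff_ne_bot.2 hμ
  obtain ⟨c, hc⟩ := Module.End.exists_eigenvalue (r.restrict hmaps)
  obtain ⟨v, hv, hv0⟩ := hc.exists_hasEigenvector
  rw [Module.End.mem_genEigenspace_one] at hv
  have hw : R (v : W) = c • ((v : W) : V) := congrArg (fun t : Module.End.eigenspace K.toLinearMap μ => ((t : W) : V)) hv
  have hw0 : ((v : W) : V) ≠ 0 := by simpa using hv0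
  have hc0 : c ≠ 0 := by
    rintro rfl
    exact hw0 (hinj _ (by rw [hw, zero_smul]))
  have he : ((v : W) : V) ∈ eigenspace B (c⁻¹ - Complex.I) := by
    rw [mem_eigenspace_iff, hg, ← add_smul, sub_add_cancel, map_smul, hw, inv_smul_smul₀ hc0]
  exact hw0 (inner_self_eq_zero.1 ((hmem _).1 (v : W).2 _ _ he))

end SpectralTheory

/-! ### Listing a family of reals in increasing order, and uniqueness of the list. -/

section Enumeration

/-- A real function with finite sublevel sets can be listed in increasing order. -/
theorem exists_sorted_enumeration {ι : Type*} (f : ι → ℝ) (hf : ∀ M, {i | f i ≤ M}.Finite) :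
    ∃ r : ι → ℕ, Function.Injective r ∧ (∀ i j, r i ≤ r j → f i ≤ f j) ∧
      ∀ n, n ∈ Set.range r ↔ 1 ≤ n ∧ (n : ℕ∞) ≤ ENat.card ι := by
  classical
  -- An arbitrary linear order on ι breaks ties. The position of i is the number of elements up to
  -- and including i, hence counts from 1.
  let _ : LinearOrder ι := linearOrderOfSTO (WellOrderingRel : ι → ι → Prop)
  let g : ι → ℝ ×ₗ ι := fun i => toLex (f i, i)
  have hgf : ∀ {i j}, g i ≤ g j → f i ≤ f j := fun {i j} h => by
    rcases Prod.Lex.toLex_le_toLex.1 h with h | h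
    · exact h.le
    · exact h.1.le
  have hginj : Function.Injective g := fun i j h => congrArg (fun t => (ofLex t).2) h
  let s : ι → Set ι := fun i => {j | g j ≤ g i}
  have hs : ∀ i, (s i).Finite := fun i => (hf (f i)).subset fun j hj => hgf hj
  have hlt : ∀ {i j}, g i < g j → (s i).ncard < (s j).ncard := fun {i j} h => by
    refine Set.ncard_lt_ncard ⟨fun k hk => le_trans hk h.le, fun h' => ?_⟩ (hs j)
    exact absurd (h' (le_refl (g j))) (not_le.2 h)
  have hle : ∀ {i j}, (s i).ncard ≤ (s j).ncard → g i ≤ g j := fun {i j} h => by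
    by_contra h'
    exact absurd (hlt (not_le.1 h')) (not_lt.2 h)
  have hinj : Function.Injective fun i => (s i).ncard := fun i j h =>
    hginj (le_antisymm (hle (le_of_eq h)) (hle (le_of_eq h.symm)))
  refine ⟨fun i => (s i).ncard, hinj, fun i j h => hgf (hle h), fun n => ⟨?_, ?_⟩⟩
  · rintro ⟨i, rfl⟩
    refine ⟨(Set.ncard_pos (hs i)).2 ⟨i, le_refl (g i)⟩, ?_⟩
    dsimp only
    rw [(hs i).cast_ncard_eq]
    exact Set.encard_le_card
  · rintro ⟨h1, h2⟩
    -- To see that position n is occupied, take n indices and let i be the largest: its position is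
    -- at least n, and the positions of the elements up to i fill 1, …, `(s i).ncard`.
    obtain ⟨t, -, ht⟩ := Set.exists_subset_encard_eq (s := (Set.univ : Set ι)) (k := n)
      (by rwa [Set.encard_univ])
    have htf : t.Finite := Set.finite_of_encard_eq_coe ht
    have htn : t.Nonempty := by
      rw [← Set.encard_pos, ht]
      exact_mod_cast h1
    obtain ⟨i, hi, hmax⟩ := Set.exists_max_image t g htf htn
    have hni : n ≤ (s i).ncard := by
      have : t.ncard = n := by
        have := htf.cast_ncard_eq
        rw [ht] at this
        exact_mod_cast this
      rw [← this]
      exact Set.ncard_le_ncard hmax (hs i)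
    have himg : (fun j => (s j).ncard) '' s i = Set.Icc 1 (s i).ncard := by
      refine Set.eq_of_subset_of_ncard_le ?_ ?_ (Set.finite_Icc _ _)
      · rintro _ ⟨j, hj, rfl⟩
        refine ⟨(Set.ncard_pos (hs j)).2 ⟨j, le_refl (g j)⟩, ?_⟩
        exact Set.ncard_le_ncard (fun k (hk : g k ≤ g j) => le_trans hk hj) (hs i)
      · rw [Set.ncard_image_of_injective _ hinj, ← Finset.coe_Icc, Set.ncard_coe_finset]
        simp
    have : n ∈ (fun j => (s j).ncard) '' s i := by
      rw [himg]
      exact ⟨h1, hni⟩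
    exact Set.image_subset_range _ _ this

/-- Two increasing sequences which take every value equally (and finitely) often agree. -/
theorem eqOn_of_monotoneOn_of_encard_eq {N : Set ℕ} {a b : ℕ → ℝ} (ha : MonotoneOn a N)
    (hb : MonotoneOn b N) (hfin : ∀ t, {j ∈ N | a j = t}.Finite)
    (h : ∀ t, {j ∈ N | a j = t}.encard = {j ∈ N | b j = t}.encard) : Set.EqOn a b N := by
  -- At a first disagreement with a j < b j, monotonicity lets b take the value a j only before j,
  -- where a = b. Then b takes that value less often than a, which also takes it at j.
  have key : ∀ {a b : ℕ → ℝ} (_ : MonotoneOn b N) (_ : ∀ t, {j ∈ N | b j = t}.Finite)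
      (_ : ∀ t, {j ∈ N | a j = t}.encard = {j ∈ N | b j = t}.encard) (j : ℕ) (_ : j ∈ N)
      (_ : ∀ i < j, i ∈ N → a i = b i), ¬ a j < b j := by
    intro a b hb hfin h j hj ih hlt
    have hsub : {i ∈ N | b i = a j} ⊆ {i ∈ N | a i = a j} \ {j} := fun i hi => by
      have hij : i < j := by
        by_contra hij
        exact absurd (hb hj hi.1 (not_lt.1 hij)) (not_le.2 (hi.2 ▸ hlt))
      exact ⟨⟨hi.1, (ih i hij hi.1).trans hi.2⟩, hij.ne⟩
    have hf' : {i ∈ N | a i = a j}.Finite := by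
      rw [← Set.encard_lt_top_iff, h]
      exact (hfin _).encard_lt_top
    have hlt' : ({i ∈ N | a i = a j} \ {j}).encard < {i ∈ N | a i = a j}.encard :=
      (hf'.sdiff).encard_lt_encard ((Set.sdiff_singleton_ssubset).2 ⟨hj, rfl⟩)
    exact absurd ((Set.encard_le_encard hsub).trans_lt hlt') (by rw [h]; exact lt_irrefl _)
  have hfin' : ∀ t, {j ∈ N | b j = t}.Finite := fun t => by
    rw [← Set.encard_lt_top_iff, ← h]
    exact (hfin _).encard_lt_top
  intro j
  induction j using Nat.strong_induction_on with
  | _ j ih =>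
    intro hj
    exact le_antisymm
      (not_lt.1 (key ha hfin (fun t => (h t).symm) j hj fun i hi hiN => (ih i hi hiN).symm))
      (not_lt.1 (key hb hfin' h j hj fun i hi hiN => ih i hi hiN))

end Enumeration

/-! ### Hilbert bases: Parseval, dimension, discreteness of the spectrum. -/

section HilbertBases

variable {V : Type*} [NormedAddCommGroup V] [InnerProductSpace ℂ V]

theorem hasSum_sq_norm_inner {ι : Type*} (b : HilbertBasis ι ℂ V) (x : V) :
    HasSum (fun i => ‖⟪b i, x⟫_ℂ‖ ^ 2) (‖x‖ ^ 2) := by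
  have h1 := Complex.hasSum_re (b.hasSum_inner_mul_inner x x)
  have h2 : (⟪x, x⟫_ℂ).re = ‖x‖ ^ 2 := inner_self_eq_norm_sq (𝕜 := ℂ) x
  rw [h2] at h1
  convert h1 using 2 with i
  rw [← inner_conj_symm x (b i), ← Complex.normSq_eq_conj_mul_self, Complex.ofReal_re,
    Complex.normSq_eq_norm_sq]

/-- A finite Hilbert basis is an algebraic basis; for an infinite one both sides always hold. Only
natural numbers are compared, since the algebraic rank may exceed the cardinality of ι. -/
theorem natCast_le_rank_iff {ι : Type*} (b : HilbertBasis ι ℂ V) (n : ℕ) :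
    (n : Cardinal) ≤ Module.rank ℂ V ↔ (n : ℕ∞) ≤ ENat.card ι := by
  rcases finite_or_infinite ι with hι | hι
  · have := Fintype.ofFinite ι
    have h1 := rank_eq_card_basis b.toOrthonormalBasis.toBasis
    rw [h1]
    simp
  · have h1 : Cardinal.aleph0 ≤ Module.rank ℂ V := by
      have := b.orthonormal.linearIndependent.cardinal_lift_le_rank
      rw [← Cardinal.lift_le, Cardinal.lift_aleph0]
      refine le_trans ?_ this
      simp
    simp [(Cardinal.natCast_le_aleph0 (n := n)).trans h1]

/-- Each v i is R((l i + i) v i), so all lie in the image under R of the ball of radius M + 1, which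
is totally bounded. Orthonormal vectors are √2 apart, so a ball of radius 1/2 contains at most one.
-/
theorem finite_of_orthonormal_of_bounded {B : V →ₗ.[ℂ] V} (hc : HasCompactResolvent B)
    {ι : Type*} {v : ι → V}
    (hv : Orthonormal ℂ v) (l : ι → ℝ) (hl : ∀ i, v i ∈ eigenspace B (l i)) (M : ℝ)
    (hM : ∀ i, |l i| ≤ M) : Finite ι := by
  obtain ⟨R, hR, hg⟩ := hc.exists_graph_iff
  obtain ⟨K, hK, hsub⟩ := hR.image_closedBall_subset_compact (M + 1)
  have hvK : ∀ i, v i ∈ K := fun i => by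
    refine hsub ⟨((l i : ℂ) + Complex.I) • v i, ?_, ?_⟩
    · rw [mem_closedBall_zero_iff, norm_smul, hv.1 i, mul_one]
      refine (norm_add_le _ _).trans ?_
      rw [Complex.norm_real, Complex.norm_I, Real.norm_eq_abs]
      linarith [hM i]
    · rw [add_smul]
      exact (hg _ _).1 (mem_eigenspace_iff.1 (hl i))
  obtain ⟨t, ht, htK⟩ := Metric.totallyBounded_iff.1 hK.totallyBounded (1 / 2) (by norm_num)
  have hex : ∀ i, ∃ y : t, dist (v i) y < 1 / 2 := fun i => by
    simpa using htK (hvK i)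
  choose c hc' using hex
  have := ht.to_subtype
  refine Finite.of_injective c fun i j hij => ?_
  by_contra hne
  have h1 : dist (v i) (v j) < 1 := by
    have h2 := hc' i
    have h3 := hc' j
    rw [← hij] at h3
    linarith [dist_triangle_right (v i) (v j) (c i)]
  have h4 : ‖v i - v j‖ ^ 2 = 2 := by
    rw [@norm_sub_sq ℂ, hv.1 i, hv.1 j, hv.2 hne]
    norm_num
  rw [dist_eq_norm] at h1
  nlinarith [norm_nonneg (v i - v j)]

end HilbertBases

/-! ### Hilbert bases of eigenvectors and arrangements of the eigenvalues. -/

section Diagonalization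

variable {V : Type*} [NormedAddCommGroup V] [InnerProductSpace ℂ V] [CompleteSpace V]
  {B : V →ₗ.[ℂ] V}

/-- Orthonormal bases of the mutually orthogonal eigenspaces are put together. Real z suffice
because every eigenvalue is real, and the sigma type builds in the multiplicities. -/
theorem exists_hilbertBasis_sigma (hB : IsSelfAdjoint B) (hc : HasCompactResolvent B) :
    ∃ b : HilbertBasis (Σ z : ℝ, Fin (Module.finrank ℂ (eigenspace B z))) ℂ V,
      ∀ i, b i ∈ eigenspace B i.1 := by
  have hfd := fun z => finiteDimensional_eigenspace hc z
  let o : ∀ z : ℝ, OrthonormalBasis (Fin (Module.finrank ℂ (eigenspace B z))) ℂ (eigenspace B z) :=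
    fun z => stdOrthonormalBasis ℂ (eigenspace B z)
  have hof : OrthogonalFamily ℂ (fun z : ℝ => eigenspace B z)
      fun z => (eigenspace B z).subtypeₗᵢ := fun s t hst x y =>
    inner_eq_zero_of_mem_eigenspace hB hst x.2 y.2
  have ho := hof.orthonormal_sigma_orthonormal (v_family := fun z => o z) fun z => (o z).orthonormal
  have htot : (Submodule.span ℂ (Set.range
      fun i : (Σ z : ℝ, Fin (Module.finrank ℂ (eigenspace B z))) =>
        (eigenspace B i.1).subtypeₗᵢ (o i.1 i.2)))ᗮ = ⊥ := by
    rw [eq_bot_iff, ← orthogonal_iSup_eigenspace hB hc]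
    refine Submodule.orthogonal_le (iSup_le fun z x hx => ?_)
    by_cases h0 : x = 0
    · rw [h0]
      exact Submodule.zero_mem _
    obtain ⟨t, rfl⟩ := Complex.conj_eq_iff_real.1 (conj_eq_of_mem_eigenspace hB hx h0)
    have h1 := (o t).sum_repr ⟨x, hx⟩
    have h2 : x = ∑ i, (o t).repr ⟨x, hx⟩ i • ((o t i : eigenspace B t) : V) := by
      conv_lhs => rw [show x = ((⟨x, hx⟩ : eigenspace B t) : V) from rfl, ← h1]
      simp
    rw [h2]
    exact Submodule.sum_mem _ fun i _ =>
      Submodule.smul_mem _ _ (Submodule.subset_span ⟨⟨t, i⟩, rfl⟩)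
  refine ⟨HilbertBasis.mkOfOrthogonalEqBot ho htot, fun i => ?_⟩
  rw [HilbertBasis.coe_mkOfOrthogonalEqBot]
  exact (o i.1 i.2).2

theorem encard_sigma_fiber (hB : IsSelfAdjoint B) (z : ℂ) :
    {i : Σ t : ℝ, Fin (Module.finrank ℂ (eigenspace B t)) | ((i.1 : ℝ) : ℂ) = z}.encard =
      Module.finrank ℂ (eigenspace B z) := by
  by_cases hz : ∃ t : ℝ, z = t
  · obtain ⟨t, rfl⟩ := hz
    have : {i : Σ t : ℝ, Fin (Module.finrank ℂ (eigenspace B t)) | ((i.1 : ℝ) : ℂ) = t} =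
        Sigma.mk t '' Set.univ := by
      ext ⟨s, i⟩
      constructor
      · intro h
        obtain rfl : s = t := by exact_mod_cast h
        exact ⟨i, trivial, rfl⟩
      · rintro ⟨j, -, h⟩
        exact congrArg (fun p => ((Sigma.fst p : ℝ) : ℂ)) h.symm
    rw [this, sigma_mk_injective.encard_image, Set.encard_univ]
    simp
  · have h1 : eigenspace B z = ⊥ := (Submodule.eq_bot_iff _).2 fun x hx => by
      by_contra h0
      exact hz (Complex.conj_eq_iff_real.1 (conj_eq_of_mem_eigenspace hB hx h0))
    have h2 : {i : Σ t : ℝ, Fin (Module.finrank ℂ (eigenspace B t)) | ((i.1 : ℝ) : ℂ) = z} = ∅ :=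
      Set.eq_empty_of_forall_notMem fun i hi => hz ⟨i.1, hi.symm⟩
    rw [h1, h2]
    simp

theorem exists_isEigenvalueSequence (hB : IsSelfAdjoint B) (hc : HasCompactResolvent B) :
    ∃ lam, IsEigenvalueSequence B lam := by
  obtain ⟨b, hb⟩ := exists_hilbertBasis_sigma hB hc
  obtain ⟨r, hinj, hmono, hrange⟩ := exists_sorted_enumeration
    (fun i : Σ t : ℝ, Fin (Module.finrank ℂ (eigenspace B t)) => |i.1|) (fun M => by
      exact Set.finite_coe_iff.1 (finite_of_orthonormal_of_bounded hc
        (b.orthonormal.comp _ Subtype.val_injective)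
        (fun i : {i : Σ t : ℝ, Fin (Module.finrank ℂ (eigenspace B t)) | |i.1| ≤ M} => i.1.1)
        (fun i => hb i) M fun i => i.2))
  have hind : ∀ n, n ∈ indices V ↔ n ∈ Set.range r := fun n => by
    rw [hrange, ← natCast_le_rank_iff b]
    rfl
  -- The default value 0 is harmless: the range of r is exactly `indices V`.
  refine ⟨Function.extend r (fun i => i.1) 0, ?_, finiteDimensional_eigenspace hc, fun z => ?_⟩
  · intro m hm n hn hmn
    obtain ⟨i, rfl⟩ := (hind m).1 hm
    obtain ⟨j, rfl⟩ := (hind n).1 hn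
    rw [hinj.extend_apply, hinj.extend_apply]
    exact hmono i j hmn
  · rw [← encard_sigma_fiber hB z, ← hinj.encard_image]
    congr 1
    ext n
    constructor
    · rintro ⟨hn, h⟩
      obtain ⟨i, rfl⟩ := (hind n).1 hn
      rw [hinj.extend_apply] at h
      exact ⟨i, h, rfl⟩
    · rintro ⟨i, h, rfl⟩
      refine ⟨(hind _).2 ⟨i, rfl⟩, ?_⟩
      rw [hinj.extend_apply]
      exact h

/-- An arrangement of the eigenvalues comes from a Hilbert basis of eigenvectors. -/
theorem IsEigenvalueSequence.exists_hilbertBasis (hB : IsSelfAdjoint B)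
    (hc : HasCompactResolvent B) {lam : ℕ → ℝ} (h : IsEigenvalueSequence B lam) :
    ∃ b : HilbertBasis (indices V) ℂ V, ∀ i : indices V, b i ∈ eigenspace B (lam i) := by
  obtain ⟨b, hb⟩ := exists_hilbertBasis_sigma hB hc
  have hcard : ∀ z : ℝ, Nonempty
      ({i : indices V // lam i = z} ≃ Fin (Module.finrank ℂ (eigenspace B z))) := fun z => by
    have h1 := h.multiplicity z
    have h2 : (Subtype.val '' {i : indices V | lam i = z}) =
        {j ∈ indices V | (lam j : ℂ) = z} := by
      ext j
      simp [and_comm]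
    rw [← h2, Subtype.val_injective.encard_image, ← ENat.card_coe_set_eq] at h1
    have : Finite {i : indices V // lam i = z} := ENat.card_lt_top.1 (by
      change ENat.card {i : indices V | lam i = z} < ⊤
      rw [h1]
      exact ENat.natCast_lt_top _)
    refine ⟨Finite.equivFinOfCardEq ?_⟩
    have h3 := ENat.card_eq_coe_natCard {i : indices V // lam i = z}
    exact_mod_cast h3.symm.trans h1
  let e := fun z => (hcard z).some
  -- The multiplicity condition matches the fibres of `lam` with those of the sigma type, so the
  -- basis can be reindexed.
  let E : indices V ≃ Σ z : ℝ, Fin (Module.finrank ℂ (eigenspace B z)) :=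
    (Equiv.sigmaFiberEquiv fun i : indices V => lam i).symm.trans (Equiv.sigmaCongrRight e)
  have hE : ∀ i, (E i).1 = lam i := fun i => rfl
  have htot : (Submodule.span ℂ (Set.range (b ∘ E)))ᗮ = ⊥ := by
    rw [E.surjective.range_comp, ← Submodule.topologicalClosure_eq_top_iff]
    exact b.dense_span
  refine ⟨HilbertBasis.mkOfOrthogonalEqBot (b.orthonormal.comp E E.injective) htot, fun i => ?_⟩
  rw [HilbertBasis.coe_mkOfOrthogonalEqBot, ← hE]
  exact hb (E i)

end Diagonalization

/-! ### Graphs of compositions, and independence of eigenspaces. -/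

theorem mem_graph_composition {V W X : Type*} [NormedAddCommGroup V] [InnerProductSpace ℂ V]
    [NormedAddCommGroup W] [InnerProductSpace ℂ W] [AddCommGroup X] [Module ℂ X]
    {B : W →ₗ.[ℂ] X} {C : V →ₗ.[ℂ] W} {x : V} {z : X} :
    (x, z) ∈ (composition B C).graph ↔ ∃ y, (x, y) ∈ C.graph ∧ (y, z) ∈ B.graph := by
  rw [LinearPMap.mem_graph_iff]
  constructor
  · rintro ⟨u, rfl, rfl⟩
    obtain ⟨u, ⟨⟨v, hv, rfl⟩, hu⟩⟩ := u
    exact ⟨C v, C.mem_graph v, B.mem_graph ⟨C v, hv⟩⟩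
  · rintro ⟨y, h1, h2⟩
    rw [LinearPMap.mem_graph_iff] at h1 h2
    obtain ⟨v, rfl, rfl⟩ := h1
    obtain ⟨w, hw, rfl⟩ := h2
    have hv : C v ∈ B.domain := by
      have := w.2
      rwa [hw] at this
    refine ⟨⟨v, ⟨⟨v, hv, rfl⟩, v.2⟩⟩, rfl, ?_⟩
    have : w = ⟨C v, hv⟩ := Subtype.ext hw
    rw [this]
    rfl

theorem disjoint_eigenspace {V : Type*} [NormedAddCommGroup V] [InnerProductSpace ℂ V]
    {B : V →ₗ.[ℂ] V} {z w : ℂ} (h : z ≠ w) :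
    Disjoint (eigenspace B z) (eigenspace B w) := by
  rw [Submodule.disjoint_def]
  intro x hx hy
  have := B.mem_graph_snd_inj (mem_eigenspace_iff.1 hx) (mem_eigenspace_iff.1 hy) rfl
  rw [← sub_eq_zero, ← sub_smul, smul_eq_zero] at this
  exact this.resolve_left (sub_ne_zero.2 h)

/-! ### The eigenvalues of |T|. -/

section AbsoluteValue

variable {V W : Type*} [NormedAddCommGroup V] [InnerProductSpace ℂ V] [CompleteSpace V]
  [NormedAddCommGroup W] [InnerProductSpace ℂ W] {B P : V →ₗ.[ℂ] V}

theorem IsOperatorAbs.re_inner_nonneg {T : V →ₗ.[ℂ] W} (hP : IsOperatorAbs T P) {x y : V}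
    (h : (x, y) ∈ P.graph) : 0 ≤ RCLike.re ⟪x, y⟫_ℂ := by
  obtain ⟨u, rfl, rfl⟩ := (LinearPMap.mem_graph_iff P).1 h
  exact hP.nonneg u

theorem IsOperatorAbs.exists_nonneg_of_mem_eigenspace {T : V →ₗ.[ℂ] W} (hP : IsOperatorAbs T P)
    {z : ℂ} {x : V} (hx : x ∈ eigenspace P z) (h0 : x ≠ 0) : ∃ t : ℝ, 0 ≤ t ∧ z = t := by
  obtain ⟨t, rfl⟩ := Complex.conj_eq_iff_real.1 (conj_eq_of_mem_eigenspace hP.isSelfAdjoint hx h0)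
  refine ⟨t, ?_, rfl⟩
  have h1 := hP.re_inner_nonneg (mem_eigenspace_iff.1 hx)
  rw [inner_smul_right, inner_self_eq_norm_sq_to_K] at h1
  have h2 : 0 ≤ t * ‖x‖ ^ 2 := by
    have h3 : (t : ℂ) * (‖x‖ : ℂ) ^ 2 = ((t * ‖x‖ ^ 2 : ℝ) : ℂ) := by push_cast; rfl
    change 0 ≤ ((t : ℂ) * (‖x‖ : ℂ) ^ 2).re at h1
    rwa [h3, Complex.ofReal_re] at h1
  have : 0 < ‖x‖ ^ 2 := by positivity
  exact nonneg_of_mul_nonneg_left h2 this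

/-- The eigenspaces of `|T|` in terms of those of a selfadjoint `B` with `B² = T* T`. -/
theorem IsOperatorAbs.eigenspace_eq {T : V →ₗ.[ℂ] W} (hP : IsOperatorAbs T P)
    (hB : IsSelfAdjoint B) (hBT : composition T.adjoint T = composition B B) {t : ℝ}
    (ht : 0 ≤ t) : eigenspace P t = eigenspace B t ⊔ eigenspace B ((-t : ℝ) : ℂ) := by
  have hsq : ∀ x z, (∃ y, (x, y) ∈ P.graph ∧ (y, z) ∈ P.graph) ↔
      ∃ y, (x, y) ∈ B.graph ∧ (y, z) ∈ B.graph := fun x z => by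
    rw [← mem_graph_composition, ← mem_graph_composition, hP.sq_eq, hBT]
  -- For selfadjoint C, C²x = 0 implies Cx = 0; this settles t = 0.
  have hker : ∀ {C : V →ₗ.[ℂ] V}, IsSelfAdjoint C → ∀ {x y : V}, (x, y) ∈ C.graph →
      (y, 0) ∈ C.graph → y = 0 := fun hC x y h h' => by
    have := inner_eq_of_mem_graph hC h' h
    rw [inner_zero_right] at this
    exact inner_self_eq_zero.1 this
  -- P²x = t²x implies Px = tx: for t > 0, Px − tx would otherwise be an eigenvector of P ≥ 0 for
  -- −t.
  have hback : ∀ x, (∃ y, (x, y) ∈ P.graph ∧ (y, (t : ℂ) • (t : ℂ) • x) ∈ P.graph) →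
      x ∈ eigenspace P t := by
    rintro x ⟨y, h1, h2⟩
    rcases ht.eq_or_lt with rfl | ht
    · rw [Complex.ofReal_zero, zero_smul] at h2
      rw [hker hP.isSelfAdjoint h1 h2] at h1
      rw [mem_eigenspace_iff]
      simpa using h1
    · have h3 : y - (t : ℂ) • x ∈ eigenspace P ((-t : ℝ) : ℂ) := by
        rw [mem_eigenspace_iff]
        have := P.graph.sub_mem h2 (P.graph.smul_mem (t : ℂ) h1)
        simp only [Prod.smul_mk, Prod.mk_sub_mk] at this
        convert this using 2
        push_cast
        module
      have h4 : y - (t : ℂ) • x = 0 := by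
        by_contra h0
        obtain ⟨s, hs, hst⟩ := hP.exists_nonneg_of_mem_eigenspace h3 h0
        have : -t = s := by exact_mod_cast hst
        linarith
      rw [mem_eigenspace_iff, ← sub_eq_zero.1 h4]
      exact h1
  have hcast : ((-t : ℝ) : ℂ) = -(t : ℂ) := by push_cast; rfl
  refine le_antisymm (fun x hx => ?_) (sup_le (fun x hx => ?_) fun x hx => ?_)
  · have hg := mem_eigenspace_iff.1 hx
    obtain ⟨y, h1, h2⟩ := (hsq x ((t : ℂ) • (t : ℂ) • x)).1 ⟨_, hg, by
      simpa using P.graph.smul_mem (t : ℂ) hg⟩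
    rcases ht.eq_or_lt with rfl | ht
    · rw [Complex.ofReal_zero, zero_smul] at h2
      rw [hker hB h1 h2] at h1
      refine Submodule.mem_sup_left (mem_eigenspace_iff.2 ?_)
      simpa using h1
    · have ht0 : (t : ℂ) ≠ 0 := by exact_mod_cast ht.ne'
      -- With y = Bx and By = t²x, the vectors tx ± y are eigenvectors for ±t or zero, and their sum
      -- is 2tx.
      have e1 : (t : ℂ) • x + y ∈ eigenspace B t := by
        rw [mem_eigenspace_iff]
        have := B.graph.add_mem (B.graph.smul_mem (t : ℂ) h1) h2
        simp only [Prod.smul_mk, Prod.mk_add_mk] at this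
        convert this using 2
        module
      have e2 : (t : ℂ) • x - y ∈ eigenspace B ((-t : ℝ) : ℂ) := by
        rw [mem_eigenspace_iff, hcast]
        have := B.graph.sub_mem (B.graph.smul_mem (t : ℂ) h1) h2
        simp only [Prod.smul_mk, Prod.mk_sub_mk] at this
        convert this using 2
        module
      have e3 : x = (2 * (t : ℂ))⁻¹ • (((t : ℂ) • x + y) + ((t : ℂ) • x - y)) := by
        rw [eq_inv_smul_iff₀ (mul_ne_zero two_ne_zero ht0)]
        module
      rw [e3]
      exact Submodule.smul_mem _ _ (Submodule.add_mem_sup e1 e2)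
  · have hg := mem_eigenspace_iff.1 hx
    exact hback x ((hsq _ _).2 ⟨_, hg, by simpa using B.graph.smul_mem (t : ℂ) hg⟩)
  · have hg := mem_eigenspace_iff.1 hx
    refine hback x ((hsq _ _).2 ⟨_, hg, ?_⟩)
    have := B.graph.smul_mem (-(t : ℂ)) hg
    rw [hcast] at this ⊢
    simpa using this

/-- The absolute values of the eigenvalues of `B` are the eigenvalues of `|T|`. -/
theorem IsEigenvalueSequence.abs {T : V →ₗ.[ℂ] W} (hP : IsOperatorAbs T P)
    (hB : IsSelfAdjoint B) (hBT : composition T.adjoint T = composition B B) {lam : ℕ → ℝ}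
    (h : IsEigenvalueSequence B lam) : IsEigenvalueSequence P fun j => |lam j| := by
  have hfd := h.finite_multiplicity
  have hbot : ∀ z : ℂ, (¬ ∃ t : ℝ, 0 ≤ t ∧ z = t) → eigenspace P z = ⊥ := fun z hz =>
    (Submodule.eq_bot_iff _).2 fun x hx => by
      by_contra h0
      exact hz (hP.exists_nonneg_of_mem_eigenspace hx h0)
  refine ⟨fun i hi j hj hij => by simpa using h.abs_le i hi j hj hij, fun z => ?_, fun z => ?_⟩
  · by_cases hz : ∃ t : ℝ, 0 ≤ t ∧ z = t
    · obtain ⟨t, ht, rfl⟩ := hz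
      rw [hP.eigenspace_eq hB hBT ht]
      infer_instance
    · rw [hbot z hz]
      infer_instance
  · by_cases hz : ∃ t : ℝ, 0 ≤ t ∧ z = t
    · obtain ⟨t, ht, rfl⟩ := hz
      rw [hP.eigenspace_eq hB hBT ht]
      have m1 := h.multiplicity t
      have m2 := h.multiplicity ((-t : ℝ) : ℂ)
      simp only [Complex.ofReal_inj] at m1 m2 ⊢
      -- At t = 0 the two eigenspaces coincide and must be counted once; for t > 0 they are disjoint
      -- and the dimensions add.
      rcases ht.eq_or_lt with rfl | ht
      · rw [neg_zero, sup_idem]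
        simpa using m1
      · have hne : (t : ℂ) ≠ ((-t : ℝ) : ℂ) := by
          intro h
          have : t = -t := by exact_mod_cast h
          linarith
        have hfin := Submodule.finrank_sup_add_finrank_inf_eq (eigenspace B t)
          (eigenspace B ((-t : ℝ) : ℂ))
        rw [(disjoint_eigenspace hne).eq_bot, finrank_bot, add_zero] at hfin
        rw [hfin, Nat.cast_add, ← m1, ← m2, ← Set.encard_union_eq]
        · congr 1
          ext j
          simp only [Set.mem_ofPred_eq, Set.mem_union, abs_eq ht.le, ← and_or_left]
        · rw [Set.disjoint_left]
          rintro j ⟨-, h1⟩ ⟨-, h2⟩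
          linarith
    · rw [hbot z hz, finrank_bot, Nat.cast_zero, Set.encard_eq_zero]
      exact Set.eq_empty_of_forall_notMem fun j hj => hz ⟨_, abs_nonneg _, hj.2.symm⟩

/-- The index j is itself counted in the multiplicity of `mu j`, so `mu j` really is an eigenvalue
of P. -/
theorem IsOperatorAbs.nonneg_of_isEigenvalueSequence {T : V →ₗ.[ℂ] W} (hP : IsOperatorAbs T P)
    {mu : ℕ → ℝ} (h : IsEigenvalueSequence P mu) {j : ℕ} (hj : j ∈ indices V) : 0 ≤ mu j := by
  have h1 : eigenspace P (mu j) ≠ ⊥ := fun h0 => by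
    have := h.multiplicity (mu j)
    rw [h0, finrank_bot, Nat.cast_zero, Set.encard_eq_zero] at this
    exact Set.notMem_empty j (this ▸ ⟨hj, rfl⟩)
  obtain ⟨x, hx, h0⟩ := (Submodule.ne_bot_iff _).1 h1
  obtain ⟨t, ht, h2⟩ := hP.exists_nonneg_of_mem_eigenspace hx h0
  have : mu j = t := by exact_mod_cast h2
  rwa [this]

/-- The eigenvalues of `|T|` have only one nondecreasing arrangement. -/
theorem IsOperatorAbs.eqOn_of_isEigenvalueSequence {T : V →ₗ.[ℂ] W} (hP : IsOperatorAbs T P)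
    {mu nu : ℕ → ℝ} (h : IsEigenvalueSequence P mu) (h' : IsEigenvalueSequence P nu) :
    Set.EqOn mu nu (indices V) := by
  have hmono : ∀ {a : ℕ → ℝ}, IsEigenvalueSequence P a → MonotoneOn a (indices V) :=
    fun {a} ha i hi j hj hij => by
      have := ha.abs_le i hi j hj hij
      rwa [abs_of_nonneg (hP.nonneg_of_isEigenvalueSequence ha hi),
        abs_of_nonneg (hP.nonneg_of_isEigenvalueSequence ha hj)] at this
  have hm : ∀ {a : ℕ → ℝ}, IsEigenvalueSequence P a → ∀ t : ℝ,
      {j ∈ indices V | a j = t}.encard = Module.finrank ℂ (eigenspace P t) := fun ha t => by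
    simpa only [Complex.ofReal_inj] using ha.multiplicity t
  refine eqOn_of_monotoneOn_of_encard_eq (hmono h) (hmono h') (fun t => ?_) fun t =>
    (hm h t).trans (hm h' t).symm
  exact Set.finite_of_encard_eq_coe (hm h t)

end AbsoluteValue

/-! ### The norm of Bx in coordinates of an eigenbasis. -/

section Coordinates

variable {V : Type*} [NormedAddCommGroup V] [InnerProductSpace ℂ V] [CompleteSpace V]
  {B : V →ₗ.[ℂ] V} {ι : Type*} {b : HilbertBasis ι ℂ V} {l : ι → ℝ}

theorem inner_apply_of_mem_graph (hB : IsSelfAdjoint B) (hb : ∀ i, b i ∈ eigenspace B (l i))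
    {x y : V} (h : (x, y) ∈ B.graph) (i : ι) : ⟪b i, y⟫_ℂ = l i * ⟪b i, x⟫_ℂ := by
  rw [← inner_eq_of_mem_graph hB h (mem_eigenspace_iff.1 (hb i)), inner_smul_left,
    Complex.conj_ofReal]

theorem hasSum_sq_norm_of_mem_graph (hB : IsSelfAdjoint B)
    (hb : ∀ i, b i ∈ eigenspace B (l i)) {x y : V} (h : (x, y) ∈ B.graph) :
    HasSum (fun i => |l i| ^ 2 * ‖⟪b i, x⟫_ℂ‖ ^ 2) (‖y‖ ^ 2) := by
  convert hasSum_sq_norm_inner b y using 2 with i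
  rw [inner_apply_of_mem_graph hB hb h, norm_mul, mul_pow, Complex.norm_real, Real.norm_eq_abs]

/-- The Parseval series of y and x are compared term by term, so the bound on |l i| is needed only
where x has a nonzero coordinate. -/
theorem norm_le_of_mem_graph (hB : IsSelfAdjoint B) (hb : ∀ i, b i ∈ eigenspace B (l i))
    {x y : V} (h : (x, y) ∈ B.graph) {C : ℝ} (hC : 0 ≤ C)
    (hl : ∀ i, ⟪b i, x⟫_ℂ ≠ 0 → |l i| ≤ C) : ‖y‖ ≤ C * ‖x‖ := by
  refine le_of_sq_le_sq ?_ (by positivity)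
  rw [mul_pow]
  refine hasSum_le (fun i => ?_) (hasSum_sq_norm_of_mem_graph hB hb h)
    ((hasSum_sq_norm_inner b x).mul_left (C ^ 2))
  by_cases h0 : ⟪b i, x⟫_ℂ = 0
  · simp [h0]
  · gcongr
    exact hl i h0

theorem le_norm_of_mem_graph (hB : IsSelfAdjoint B) (hb : ∀ i, b i ∈ eigenspace B (l i))
    {x y : V} (h : (x, y) ∈ B.graph) {C : ℝ} (hC : 0 ≤ C)
    (hl : ∀ i, ⟪b i, x⟫_ℂ ≠ 0 → C ≤ |l i|) : C * ‖x‖ ≤ ‖y‖ := by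
  refine le_of_sq_le_sq ?_ (by positivity)
  rw [mul_pow]
  refine hasSum_le (fun i => ?_) ((hasSum_sq_norm_inner b x).mul_left (C ^ 2))
    (hasSum_sq_norm_of_mem_graph hB hb h)
  by_cases h0 : ⟪b i, x⟫_ℂ = 0
  · simp [h0]
  · gcongr
    exact hl i h0

end Coordinates

/-- A subspace of dimension greater than `dim F` meets the orthogonal complement of `F`. -/
theorem exists_mem_orthogonal_of_finrank_lt {V : Type*} [NormedAddCommGroup V]
    [InnerProductSpace ℂ V] {F G : Submodule ℂ V} [FiniteDimensional ℂ F]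
    [FiniteDimensional ℂ G] (h : Module.finrank ℂ F < Module.finrank ℂ G) :
    ∃ x ∈ G, x ∈ Fᗮ ∧ x ≠ 0 := by
  obtain ⟨x, hx, h0⟩ := (Submodule.ne_bot_iff _).1 (LinearMap.ker_ne_bot_of_finrank_lt
    (f := (F.orthogonalProjectionOnto : V →ₗ[ℂ] F) ∘ₗ G.subtype) h)
  exact ⟨x, x.2, Submodule.orthogonalProjectionOnto_eq_zero_iff.1 hx, by simpa using h0⟩

/-! ### The min-max principle. -/

section MinMax

variable {V : Type*} [NormedAddCommGroup V] [InnerProductSpace ℂ V] [CompleteSpace V]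
  {B : V →ₗ.[ℂ] V}

/-- The min-max principle. -/
theorem IsEigenvalueSequence.isLUB (hB : IsSelfAdjoint B) (hc : HasCompactResolvent B)
    {lam : ℕ → ℝ} (h : IsEigenvalueSequence B lam) {j : ℕ} (hj : j ∈ indices V) :
    IsLUB {r : ℝ | ∃ F : Submodule ℂ V, Module.rank ℂ F = ((j - 1 : ℕ) : Cardinal) ∧
      IsGLB {t : ℝ | ∃ ζ : B.domain, (ζ : V) ∈ Fᗮ ∧ ‖(ζ : V)‖ = 1 ∧ t = ‖B ζ‖} r} |lam j| := by
  obtain ⟨b, hb⟩ := h.exists_hilbertBasis hB hc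
  have hlower : ∀ i, 1 ≤ i → i ≤ j → i ∈ indices V := fun i h1 h2 =>
    ⟨h1, le_trans (by exact_mod_cast h2) hj.2⟩
  -- The shift k + 1 reflects that indices start at 1; `G n` below is the span of b_1, …, b_n.
  let u : ∀ n ≤ j, Fin n → indices V := fun n hn k => ⟨k + 1, hlower _ (by omega) (by omega)⟩
  have hu : ∀ n hn, Function.Injective (u n hn) := fun n hn k k' hk => by
    have : (k : ℕ) + 1 = k' + 1 := congrArg Subtype.val hk
    exact Fin.ext (by omega)
  have hli : ∀ n hn, LinearIndependent ℂ (b ∘ u n hn) := fun n hn =>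
    b.orthonormal.linearIndependent.comp _ (hu n hn)
  let G : ∀ n ≤ j, Submodule ℂ V := fun n hn => Submodule.span ℂ (Set.range (b ∘ u n hn))
  have hG : ∀ n hn, Module.finrank ℂ (G n hn) = n := fun n hn => by
    rw [finrank_span_eq_card (hli n hn), Fintype.card_fin]
  have hGfd : ∀ n hn, FiniteDimensional ℂ (G n hn) := fun n hn =>
    FiniteDimensional.span_of_finite ℂ (Set.finite_range _)
  have hdom : ∀ i, (b i, (lam i : ℂ) • b i) ∈ B.graph := fun i => mem_eigenspace_iff.1 (hb i)
  have hGdom : ∀ n hn, G n hn ≤ B.domain := fun n hn => Submodule.span_le.2 (by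
    rintro _ ⟨k, rfl⟩
    exact LinearPMap.mem_domain_of_mem_graph (hdom _))
  constructor
  -- Upper bound: a unit vector of `G j` orthogonal to F involves only eigenvalues of modulus at
  -- most `|lam j|`.
  · rintro r ⟨F, hF, hr⟩
    have hFfd : FiniteDimensional ℂ F :=
      Module.rank_lt_aleph0_iff.1 (by rw [hF]; exact Cardinal.natCast_lt_aleph0)
    have hlt : Module.finrank ℂ F < Module.finrank ℂ (G j le_rfl) := by
      rw [hG j le_rfl, Module.finrank_eq_of_rank_eq hF]
      exact Nat.sub_lt hj.1 one_pos
    have := hGfd j le_rfl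
    obtain ⟨x, hxG, hxF, hx0⟩ := exists_mem_orthogonal_of_finrank_lt hlt
    have hx1 : ‖x‖ ≠ 0 := norm_ne_zero_iff.2 hx0
    let e : V := ((‖x‖⁻¹ : ℝ) : ℂ) • x
    have heG : e ∈ G j le_rfl := Submodule.smul_mem _ _ hxG
    have he1 : ‖e‖ = 1 := by
      rw [norm_smul, Complex.norm_real, norm_inv, norm_norm, inv_mul_cancel₀ hx1]
    refine (hr.1 ⟨⟨e, hGdom j le_rfl heG⟩, Submodule.smul_mem _ _ hxF, he1, rfl⟩).trans ?_
    have := norm_le_of_mem_graph (l := fun i : indices V => lam i) hB hb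
      (B.mem_graph ⟨e, hGdom j le_rfl heG⟩) (abs_nonneg (lam j)) fun i hi => by
        refine h.abs_le i i.2 j hj ?_
        by_contra hij
        refine hi ?_
        have : G j le_rfl ≤ (ℂ ∙ b i)ᗮ := Submodule.span_le.2 (by
          rintro _ ⟨k, rfl⟩
          rw [SetLike.mem_coe, Submodule.mem_orthogonal_singleton_iff_inner_right]
          refine b.orthonormal.2 fun hk => hij ?_
          rw [hk]
          change (k : ℕ) + 1 ≤ j
          omega)
        exact Submodule.mem_orthogonal_singleton_iff_inner_right.1 (this heG)
    simpa [he1] using this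
  · intro s hs
    have hj1 := hj.1
    -- The supremum is attained at F = `G (j - 1)`: vectors orthogonal to it only have coordinates
    -- of index at least j, and the infimum is attained at b_j.
    refine hs ⟨G (j - 1) (Nat.sub_le _ _), ?_, ?_, ?_⟩
    · have := hGfd (j - 1) (Nat.sub_le _ _)
      rw [← Module.finrank_eq_rank, hG (j - 1) (Nat.sub_le _ _)]
    · rintro _ ⟨ζ, hζ, hζ1, rfl⟩
      have := le_norm_of_mem_graph (l := fun i : indices V => lam i) hB hb
        (B.mem_graph ζ) (abs_nonneg (lam j)) fun i hi => by
          refine h.abs_le j hj i i.2 ?_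
          by_contra hij
          refine hi ((Submodule.mem_orthogonal _ _).1 hζ _ (Submodule.subset_span ?_))
          have hi1 := i.2.1
          exact ⟨⟨i - 1, by omega⟩, congrArg b (Subtype.ext (Nat.sub_add_cancel hi1))⟩
      simpa [hζ1] using this
    · intro t ht
      obtain ⟨ζ, hζ, hζ'⟩ := (LinearPMap.mem_graph_iff B).1 (hdom ⟨j, hj⟩)
      dsimp only at hζ hζ'
      refine ht ⟨ζ, ?_, ?_, ?_⟩
      · have : G (j - 1) (Nat.sub_le _ _) ≤ (ℂ ∙ b ⟨j, hj⟩)ᗮ := Submodule.span_le.2 (by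
          rintro _ ⟨k, rfl⟩
          rw [SetLike.mem_coe, Submodule.mem_orthogonal_singleton_iff_inner_right]
          refine b.orthonormal.2 fun hk => ?_
          have : j = (k : ℕ) + 1 := congrArg Subtype.val hk
          omega)
        rw [hζ, Submodule.mem_orthogonal]
        exact fun w hw => Submodule.mem_orthogonal_singleton_iff_inner_left.1 (this hw)
      · rw [hζ]
        exact b.orthonormal.1 _
      · rw [hζ', norm_smul, b.orthonormal.1, mul_one, Complex.norm_real, Real.norm_eq_abs]

end MinMax

/-! ### Construction of |T|. -/

section ExistsAbs

variable {V W : Type*} [NormedAddCommGroup V] [InnerProductSpace ℂ V] [CompleteSpace V]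
  [NormedAddCommGroup W] [InnerProductSpace ℂ W] {B : V →ₗ.[ℂ] V}

/-- A unitary involution which multiplies `b i` by the sign of `l i`. -/
theorem exists_sign_isometry {ι : Type*} (b : HilbertBasis ι ℂ V) (l : ι → ℝ) :
    ∃ J : V ≃ₗᵢ[ℂ] V, (∀ x, J (J x) = x) ∧
      ∀ i, J (b i) = ((if 0 ≤ l i then 1 else -1 : ℝ) : ℂ) • b i := by
  let N : Submodule ℂ V := Submodule.span ℂ (b '' {i | l i < 0})
  refine ⟨Nᗮ.reflection, Nᗮ.reflection_reflection, fun i => ?_⟩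
  split_ifs with hi
  · rw [Submodule.reflection_mem_subspace_eq_self, Complex.ofReal_one, one_smul]
    have : N ≤ (ℂ ∙ b i)ᗮ := Submodule.span_le.2 (by
      rintro _ ⟨k, hk, rfl⟩
      rw [SetLike.mem_coe, Submodule.mem_orthogonal_singleton_iff_inner_right]
      refine b.orthonormal.2 ?_
      rintro rfl
      exact absurd hk (not_lt.2 hi))
    rw [Submodule.mem_orthogonal]
    exact fun w hw => Submodule.mem_orthogonal_singleton_iff_inner_left.1 (this hw)
  · rw [Submodule.reflection_mem_subspace_orthogonalComplement_eq_neg, Complex.ofReal_neg,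
      Complex.ofReal_one, neg_one_smul]
    exact Submodule.le_orthogonal_orthogonal _ (Submodule.subset_span ⟨i, not_le.1 hi, rfl⟩)

/-- In coordinates, ⟨x, JBx⟩ = ∑ |l i| |⟨b i, x⟩|². -/
theorem re_inner_sign_isometry_nonneg (hB : IsSelfAdjoint B) {ι : Type*} {b : HilbertBasis ι ℂ V}
    {l : ι → ℝ} (hb : ∀ i, b i ∈ eigenspace B (l i)) {J : V ≃ₗᵢ[ℂ] V} (hJJ : ∀ x, J (J x) = x)
    (hJb : ∀ i, J (b i) = ((if 0 ≤ l i then 1 else -1 : ℝ) : ℂ) • b i) {x y : V}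
    (h : (x, y) ∈ B.graph) : 0 ≤ RCLike.re ⟪x, J y⟫_ℂ := by
  have h1 := Complex.hasSum_re (b.hasSum_inner_mul_inner x (J y))
  refine h1.nonneg fun i => ?_
  have h2 : ⟪b i, J y⟫_ℂ = ((|l i| : ℝ) : ℂ) * ⟪b i, x⟫_ℂ := by
    rw [← J.inner_map_map, hJJ, hJb, inner_smul_left, inner_apply_of_mem_graph hB hb h,
      Complex.conj_ofReal, ← mul_assoc, ← Complex.ofReal_mul]
    congr 2
    split_ifs with h
    · rw [abs_of_nonneg h, one_mul]
    · rw [abs_of_neg (not_le.1 h), neg_one_mul]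
  rw [h2, mul_left_comm, ← inner_conj_symm x (b i), ← Complex.normSq_eq_conj_mul_self,
    ← Complex.ofReal_mul, Complex.ofReal_re]
  exact mul_nonneg (abs_nonneg _) (Complex.normSq_nonneg _)

/-- Take P = JB with J the sign of B. Both J and R are diagonal in the eigenbasis, so J commutes
with R and therefore with B, domain included. Hence JB is selfadjoint, and (JB)² = B² = T*T as J² =
1. -/
theorem exists_isOperatorAbs (hB : IsSelfAdjoint B) (hc : HasCompactResolvent B)
    {T : V →ₗ.[ℂ] W} (hBT : composition T.adjoint T = composition B B) :
    ∃ P, IsOperatorAbs T P := by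
  obtain ⟨b, hb⟩ := exists_hilbertBasis_sigma hB hc
  obtain ⟨R, -, hg⟩ := hc.exists_graph_iff
  obtain ⟨J, hJJ, hJb⟩ := exists_sign_isometry b fun i => i.1
  have hJadj : ∀ x y, ⟪J x, y⟫_ℂ = ⟪x, J y⟫_ℂ := fun x y => by
    rw [← J.inner_map_map, hJJ]
  have hcomm : ∀ x, J (R x) = R (J x) := by
    have : (J : V →L[ℂ] V) ∘L R = R ∘L (J : V →L[ℂ] V) := by
      refine ContinuousLinearMap.ext_on
        (Submodule.dense_iff_topologicalClosure_eq_top.2 b.dense_span) ?_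
      rintro _ ⟨i, rfl⟩
      have h1 := (hg _ _).1 (mem_eigenspace_iff.1 (hb i))
      rw [← add_smul, map_smul] at h1
      have h0 : (i.1 : ℂ) + Complex.I ≠ 0 := fun h => by
        rw [h, zero_smul] at h1
        exact b.orthonormal.ne_zero i h1.symm
      have h2 := (eq_inv_smul_iff₀ h0).2 h1
      change J (R (b i)) = R (J (b i))
      rw [h2, hJb, map_smul, map_smul, hJb, h2, smul_comm]
    exact fun x => congrArg (fun N : V →L[ℂ] V => N x) this
  have hJg : ∀ {x y}, (x, y) ∈ B.graph → (J x, J y) ∈ B.graph := fun {x y} h => by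
    rw [hg] at h ⊢
    rw [← map_smul, ← map_add, ← hcomm, h]
  let P : V →ₗ.[ℂ] V := (J.toLinearEquiv : V →ₗ[ℂ] V).compPMap B
  have hP : ∀ x z, (x, z) ∈ P.graph ↔ (x, J z) ∈ B.graph := fun x z => by
    rw [LinearPMap.mem_graph_iff, LinearPMap.mem_graph_iff]
    constructor
    · rintro ⟨u, hu, hz⟩
      refine ⟨u, hu, ?_⟩
      dsimp only at *
      rw [← hz]
      exact (hJJ _).symm
    · rintro ⟨u, hu, hz⟩
      refine ⟨u, hu, ?_⟩
      dsimp only at *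
      change J (B u) = z
      rw [hz, hJJ]
  refine ⟨P, ?_, fun x => ?_, ?_⟩
  · rw [LinearPMap.isSelfAdjoint_def]
    refine LinearPMap.eq_of_eq_graph ?_
    rw [LinearPMap.adjoint_graph_eq_graph_adjoint (T := P) hB.dense_domain]
    ext ⟨x, y⟩
    have h1 : (x, J y) ∈ B.graph ↔ (J x, y) ∈ B.graph :=
      ⟨fun h => by simpa only [hJJ] using hJg h, fun h => by simpa only [hJJ] using hJg h⟩
    rw [hP, h1, mem_graph_iff_forall_inner hB, Submodule.mem_adjoint_iff]
    simp only [sub_eq_zero]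
    constructor
    · intro h a c hac
      rw [← hJadj]
      refine h a _ ((hP _ _).2 ?_)
      rwa [hJJ]
    · intro h a c hac
      rw [← h a _ ((hP _ _).1 hac), hJadj, hJJ]
  · exact re_inner_sign_isometry_nonneg hB hb hJJ hJb (B.mem_graph x)
  · rw [hBT]
    refine LinearPMap.eq_of_eq_graph (Submodule.ext fun ⟨x, z⟩ => ?_)
    rw [mem_graph_composition, mem_graph_composition]
    simp only [hP]
    constructor
    · rintro ⟨y, h1, h2⟩
      exact ⟨J y, h1, by simpa only [hJJ] using hJg h2⟩
    · rintro ⟨y, h1, h2⟩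
      exact ⟨J y, by rwa [hJJ], hJg h2⟩

end ExistsAbs

/-! ### From T to the selfadjoint operator ST. -/

section Bridge

variable {V W : Type*} [NormedAddCommGroup V] [InnerProductSpace ℂ V] [CompleteSpace V]
  [NormedAddCommGroup W] [InnerProductSpace ℂ W]

/-- If `S` is unitary and `S T` is selfadjoint, then `T* T = (S T)²`. -/
theorem adjoint_composition_self (S : W ≃ₗᵢ[ℂ] V) (T : V →ₗ.[ℂ] W)
    (hB : IsSelfAdjoint ((S.toLinearEquiv : W →ₗ[ℂ] V).compPMap T)) :
    composition T.adjoint T = composition ((S.toLinearEquiv : W →ₗ[ℂ] V).compPMap T)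
      ((S.toLinearEquiv : W →ₗ[ℂ] V).compPMap T) := by
  have hT : Dense (T.domain : Set V) := hB.dense_domain
  set B := (S.toLinearEquiv : W →ₗ[ℂ] V).compPMap T with hBdef
  have hgr : ∀ x y, (x, S y) ∈ B.graph ↔ (x, y) ∈ T.graph := fun x y => by
    rw [LinearPMap.mem_graph_iff, LinearPMap.mem_graph_iff]
    exact exists_congr fun u => and_congr_right fun _ => S.injective.eq_iff
  -- Since T = S⁻¹B with S unitary and B = B*, the adjoint is T* = BS.
  have hadj : ∀ y z, (y, z) ∈ T.adjoint.graph ↔ (S y, z) ∈ B.graph := fun y z => by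
    rw [LinearPMap.adjoint_graph_eq_graph_adjoint hT, Submodule.mem_adjoint_iff,
      mem_graph_iff_forall_inner hB]
    simp only [sub_eq_zero]
    constructor
    · intro h a c hac
      obtain ⟨d, rfl⟩ := S.surjective c
      rw [S.inner_map_map]
      exact h a d ((hgr _ _).1 hac)
    · intro h a d had
      rw [← S.inner_map_map]
      exact h a _ ((hgr _ _).2 had)
  refine LinearPMap.eq_of_eq_graph (Submodule.ext fun ⟨x, z⟩ => ?_)
  rw [mem_graph_composition, mem_graph_composition]
  constructor
  · rintro ⟨y, h1, h2⟩
    exact ⟨S y, (hgr _ _).2 h1, (hadj _ _).1 h2⟩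
  · rintro ⟨y, h1, h2⟩
    obtain ⟨d, rfl⟩ := S.surjective y
    exact ⟨d, (hgr _ _).1 h1, (hadj _ _).2 h2⟩

end Bridge

/-! ### 𝔰-selfadjointness as selfadjointness. -/

section SComp

variable {A H : Type*} [Ring A] [StarRing A] [Algebra ℂ A] [StarModule ℂ A]
  [NormedAddCommGroup H] [InnerProductSpace ℂ H] [CompleteSpace H]
  {𝒯 : TwistedSpectralTriple A H}
  {E Eσ : Type*} [AddCommGroup E] [Module ℂ E] [Module Aᵐᵒᵖ E] [IsScalarTower ℂ Aᵐᵒᵖ E]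
  [Module.Finite Aᵐᵒᵖ E] [Module.Projective Aᵐᵒᵖ E]
  [AddCommGroup Eσ] [Module ℂ Eσ] [Module Aᵐᵒᵖ Eσ] [IsScalarTower ℂ Aᵐᵒᵖ Eσ]
  [Module.Finite Aᵐᵒᵖ Eσ] [Module.Projective Aᵐᵒᵖ Eσ]
  {τ : SigmaTranslation 𝒯.σ E Eσ}

/-- The condition ⟨ξ, STζ⟩ = ⟨Sη, ζ⟩ for all ζ, once conjugated, says that (ξ, Sη) lies in the graph
of (ST)*. So ST† = (ST)*, and T = T† becomes ST = (ST)*. -/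
theorem SigmaHermitianStructure.isSelfAdjoint_sComp (𝔥 : SigmaHermitianStructure 𝒯 τ)
    {T : 𝔥.HE →ₗ.[ℂ] 𝔥.HEσ} (hdense : Dense (T.domain : Set 𝔥.HE))
    (hself : 𝔥.IsSSelfAdjoint T) : IsSelfAdjoint (𝔥.sComp T) := by
  rw [LinearPMap.isSelfAdjoint_def]
  refine LinearPMap.eq_of_eq_graph (Submodule.ext fun ⟨x, y⟩ => ?_)
  have h1 := 𝔥.sAdjoint_graph T hdense
  rw [← show T = 𝔥.sAdjoint T from hself] at h1
  obtain ⟨w, rfl⟩ := 𝔥.S.surjective y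
  have h2 : (x, 𝔥.S w) ∈ (𝔥.sComp T).graph ↔ (x, w) ∈ 𝔥.sAdjointGraph T := by
    rw [← h1, LinearPMap.mem_graph_iff, LinearPMap.mem_graph_iff]
    exact exists_congr fun u => and_congr_right fun _ => 𝔥.S.injective.eq_iff
  rw [h2, LinearPMap.adjoint_graph_eq_graph_adjoint (T := 𝔥.sComp T) hdense,
    Submodule.mem_adjoint_iff]
  simp only [sub_eq_zero]
  constructor
  · intro h z
    have := h z _ ((𝔥.sComp T).mem_graph z)
    have h3 := congrArg (starRingEnd ℂ) this
    rw [inner_conj_symm, inner_conj_symm] at h3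
    exact h3
  · intro h a c hac
    obtain ⟨u, rfl, rfl⟩ := (LinearPMap.mem_graph_iff _).1 hac
    have h3 := congrArg (starRingEnd ℂ) (h u)
    unfold rightPairing leftPairing at h3
    rw [inner_conj_symm, inner_conj_symm] at h3
    exact h3

end SComp

end TwistedGeometry

/-! ### The main theorem. -/

theorem mainTheorem11 {A H : Type*} [Ring A] [StarRing A] [Algebra ℂ A] [StarModule ℂ A]
    [NormedAddCommGroup H] [InnerProductSpace ℂ H] [CompleteSpace H]
    (𝒯 : TwistedSpectralTriple A H)
    {E Eσ : Type*} [AddCommGroup E] [Module ℂ E] [Module Aᵐᵒᵖ E] [IsScalarTower ℂ Aᵐᵒᵖ E]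
    [Module.Finite Aᵐᵒᵖ E] [Module.Projective Aᵐᵒᵖ E]
    [AddCommGroup Eσ] [Module ℂ Eσ] [Module Aᵐᵒᵖ Eσ] [IsScalarTower ℂ Aᵐᵒᵖ Eσ]
    [Module.Finite Aᵐᵒᵖ Eσ] [Module.Projective Aᵐᵒᵖ Eσ]
    (τ : SigmaTranslation 𝒯.σ E Eσ) (𝔥 : SigmaHermitianStructure 𝒯 τ)
    (T : 𝔥.HE →ₗ.[ℂ] 𝔥.HEσ) (hdense : Dense (T.domain : Set 𝔥.HE))
    (hfred : IsFredholm T) (hself : 𝔥.IsSSelfAdjoint T)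
    (hcomp : HasCompactResolvent (𝔥.sComp T)) :
    (∃ lam, IsEigenvalueSequence (𝔥.sComp T) lam) ∧
    (∃ P, IsOperatorAbs T P) ∧
    (∀ P, IsOperatorAbs T P → ∃ mu, IsEigenvalueSequence P mu) ∧
    ∀ (lam : ℕ → ℝ) (P : 𝔥.HE →ₗ.[ℂ] 𝔥.HE) (mu : ℕ → ℝ),
      IsEigenvalueSequence (𝔥.sComp T) lam → IsOperatorAbs T P → IsEigenvalueSequence P mu →
      ∀ j ∈ indices 𝔥.HE,
        |lam j| = mu j ∧
        IsLUB {r : ℝ | ∃ F : Submodule ℂ 𝔥.HE, Module.rank ℂ F = ((j - 1 : ℕ) : Cardinal) ∧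
            IsGLB {t : ℝ | ∃ ζ : T.domain, (ζ : 𝔥.HE) ∈ Fᗮ ∧ ‖(ζ : 𝔥.HE)‖ = 1 ∧ t = ‖T ζ‖} r}
          (mu j) := by
  have hB := 𝔥.isSelfAdjoint_sComp hdense hself
  have hBT : composition T.adjoint T = composition (𝔥.sComp T) (𝔥.sComp T) :=
    adjoint_composition_self 𝔥.S T hB
  obtain ⟨lam, hlam⟩ := exists_isEigenvalueSequence hB hcomp
  refine ⟨⟨lam, hlam⟩, exists_isOperatorAbs hB hcomp hBT,
    fun P hP => ⟨_, hlam.abs hP hB hBT⟩, fun lam P mu hlam hP hmu j hj => ?_⟩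
  have h1 : |lam j| = mu j :=
    hP.eqOn_of_isEigenvalueSequence (hlam.abs hP hB hBT) hmu hj
  refine ⟨h1, ?_⟩
  -- S is isometric and dom ST = dom T, so the min-max formula for T is the one for ST.
  have hnorm : ∀ ζ : T.domain, ‖T ζ‖ = ‖𝔥.sComp T ζ‖ := fun ζ => (𝔥.S.norm_map (T ζ)).symm
  simp only [hnorm]
  rw [← h1]
  exact hlam.isLUB hB hcomp hj
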